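/- **Setting.** Let $I\subset\mathbb R$ (times) and $\Omega\subset\mathbb R^3$ be open, $g\in\mathbb R$, $\mathbf R:\Omega\to\mathbb R^3$ of class $C^1$ (rotation), and let $\omega$ be a dispersion relation of class $C^2$ on an open set $U\subset\mathbb R^3$ of wave vectors, with group velocity $\mathbf v_G(\mathbf k)=\partial\omega/\partial\mathbf k$. Let $\mathbf u$ (Lagrangian mean velocity), $D,b,\mathsf p$ (density, buoyancy, pressure), $N$ (wave action density) be $C^1$ and $\phi$ (wave phase) be $C^2$ on $I\times\Omega$, with $N\ne0$ and $\mathbf k:=\nabla\phi\in U$ everywhere. Put $\mathbf p:=N\nabla\phi$, $\pi:=\tfrac12|\mathbf u|^2+\mathbf R\cdot\mathbf u-gbz-\mathsf p$, $\mathbf m:=D(\mathbf u+\mathbf R)-N\nabla\phi$, and for a momentum density $\mathbf q$ $$\mathcal M(\mathbf q):=\partial_t\mathbf q+(\mathbf u\cdot\nabla)\mathbf q+(\nabla\mathbf u)^T\cdot\mathbf q+\mathbf q\,\mathrm{div}\,\mathbf u .$$ Let $H_W(N,\mathbf k)=-\int_\Omega N\,\omega(\mathbf k)\,d^3x$, which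 in Lie–Poisson variables reads $H_W(\mathbf p/N,N)=-\int_\Omega N\,\omega(\mathbf p/N)\,d^3x$; assume that $N\omega(\mathbf k)$ and $\mathbf p\cdot\mathbf u$ are integrable over $\Omega$ at each time. Variational derivatives are taken with respect to the $L^2(\Omega)$ pairing and smooth variations compactly supported in $\Omega$. For $s\in\mathbb R$, the *wave–current equations* with wave-force coefficient $s$ are $$\mathcal M(\mathbf m)=D\nabla\pi+Dgz\nabla b+s\Big(\mathbf k\,\mathrm{div}\frac{\delta H_W}{\delta\mathbf k}+N\nabla\frac{\delta H_W}{\delta N}\Big),$$ $$\partial_tD+\mathrm{div}(D\mathbf u)=0,\quad D=1,\quad \partial_tb+\mathbf u\cdot\nabla b=0,$$ $$\partial_t\phi+\mathbf u\cdot\nabla\phi-\frac{\delta H_W}{\delta N}=0,\quad \partial_tN+\mathrm{div}(N\mathbf u)-\mathrm{div}\frac{\delta H_W}{\delta\mathbf k}=0,$$ where the variational derivatives ($C^1$ on $\Omega$) are taken at $(N,\nabla\phi)$. ($s=1$ is the motion equation with wave force acting on $\mathbf m$; $s=0$ is the Euler–Poincaré equation in which the total momentum $\mathbf m$ feels no wave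 force, equivalently the wave force acts on $D(\mathbf u+\mathbf R)$; for $s=-1$ the waves drop out of the equation for $\mathbf u$.) The *closed GLM Euler–Boussinesq system* in the variables $(\mathbf u,D,b,\mathsf p,\mathbf p,N)$ consists of $$\mathcal M\big(D(\mathbf u+\mathbf R)-\mathbf p\big)=D\nabla\pi+Dgz\nabla b-s\,\mathbf F_W,\qquad \mathbf F_W:=\tfrac{\mathbf p}{N}\,\mathrm{div}\big(N\mathbf v_G(\tfrac{\mathbf p}{N})\big)+N\nabla\,\omega(\tfrac{\mathbf p}{N}),$$ the same equations for $D$ and $b$, and the wave equations $$\partial_t\begin{bmatrix}p_j\\N\end{bmatrix}=-\begin{bmatrix}p_k\partial_j+\partial_kp_j&N\partial_j\\ \partial_kN&0\end{bmatrix}\begin{bmatrix}u^k+v_G^k(\mathbf p/N)\\ \omega(\mathbf p/N)-N^{-1}\mathbf p\cdot\mathbf v_G(\mathbf p/N)\end{bmatrix}.$$ **Proposition.** 1. $\frac{\delta H_W}{\delta N}\big|_{\mathbf k}=-\omega(\mathbf k)$ and $\frac{\delta H_W}{\delta\mathbf k}\big|_N=-N\mathbf v_G(\mathbf k)$ at $(N,\nabla\phi)$.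 2. At $\mathbf p=N\nabla\phi$: $\frac{\delta H_W}{\delta\mathbf p}\big|_N=-\mathbf v_G(\mathbf p/N)$ and $\frac{\delta H_W}{\delta N}\big|_{\mathbf p}=-\omega(\mathbf p/N)+N^{-1}\mathbf p\cdot\mathbf v_G(\mathbf p/N)$. The wave Hamiltonian in the moving fluid, $\mathcal H=\int_\Omega\mathbf p\cdot\mathbf u\,d^3x-H_W(\mathbf p/N,N)$, has $\frac{\delta\mathcal H}{\delta\mathbf p}\big|_N=\mathbf u+\mathbf v_G(\mathbf p/N)$ and $\frac{\delta\mathcal H}{\delta N}\big|_{\mathbf p}=\omega(\mathbf p/N)-N^{-1}\mathbf p\cdot\mathbf v_G(\mathbf p/N)$. 3. For every $s$, the wave–current equations hold if and only if the closed GLM system holds with $\mathbf p=N\nabla\phi$ and $\partial_t\phi+\mathbf u\cdot\nabla\phi=-\omega(\nabla\phi)$. 4. If $\Omega$ is connected, the closed GLM system with $\mathbf p=N\nabla\phi$ already implies that $\partial_t\phi+\mathbf u\cdot\nabla\phi+\omega(\nabla\phi)$ is a function of $t$ only. 5. The wave part of the closed GLM system is Lie–Poisson on the dual of the semidirect product $\mathfrak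 X\,\circledS\,C^\infty$: with $(\boldsymbol\xi,\sigma)=(\delta\mathcal H/\delta\mathbf p,\delta\mathcal H/\delta N)$ and all smooth $(\boldsymbol\eta,\tau)$ compactly supported in $\Omega$, $$\int_\Omega\big(\partial_t\mathbf p\cdot\boldsymbol\eta+\partial_tN\,\tau\big)d^3x=\int_\Omega\big(\mathbf p\cdot[\boldsymbol\xi,\boldsymbol\eta]+N(\boldsymbol\xi\cdot\nabla\tau-\boldsymbol\eta\cdot\nabla\sigma)\big)d^3x,\quad[\boldsymbol\xi,\boldsymbol\eta]=\boldsymbol\xi\cdot\nabla\boldsymbol\eta-\boldsymbol\eta\cdot\nabla\boldsymbol\xi .$$ 6. The closed GLM system with $\mathbf p=N\nabla\phi$ splits into $\mathcal M(\mathbf p)=-\mathbf F_W$ for the waves and $\mathcal M(D(\mathbf u+\mathbf R))=D\nabla\pi+Dgz\nabla b-(1+s)\mathbf F_W$ for the current. -/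

import Mathlib

open MeasureTheory Set
open scoped RealInnerProductSpace

noncomputable section

namespace WCI

/-- Physical space `ℝ³`; the vertical coordinate `z` of `x` is `x 2`. -/
abbrev E : Type := EuclideanSpace ℝ (Fin 3)

/-- Partial derivative `∂ᵢ f`. -/
def pd (i : Fin 3) (f : E → ℝ) (x : E) : ℝ := fderiv ℝ f x (EuclideanSpace.single i 1)

/-- Divergence of a vector field. -/
def dvg (F : E → E) (x : E) : ℝ := ∑ i, pd i (fun y => F y i) x

/-- Wave vector `k = ∇φ` at time `t`. -/
def waveVec (φ : ℝ → E → ℝ) (t : ℝ) (x : E) : E := gradient (φ t) x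

/-- Pseudomomentum density `p = N ∇φ`. -/
def pseudomom (N φ : ℝ → E → ℝ) (t : ℝ) (x : E) : E := N t x • waveVec φ t x

/-- Group velocity `v_G(k) = ∂ω/∂k`. -/
def groupVel (ω : E → ℝ) (k : E) : E := gradient ω k

/-- `g` is the variational derivative `δF/δf` of the functional `F` at `f`, for the `L²` pairing
over `Ω` and smooth variations compactly supported in `Ω`. -/
def HasVarDeriv {V : Type} [NormedAddCommGroup V] [InnerProductSpace ℝ V]
    (Ω : Set E) (F : (E → V) → ℝ) (f g : E → V) : Prop :=
  ∀ η : E → V, ContDiff ℝ (⊤ : ℕ∞) η → HasCompactSupport η → tsupport η ⊆ Ω →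
    HasDerivAt (fun ε : ℝ => F (fun x => f x + ε • η x)) (∫ x in Ω, ⟪g x, η x⟫) 0

/-- WKB wave Hamiltonian `H_W(N, k) = - ∫ N ω(k) d³x`. -/
def waveHam (Ω : Set E) (ω : E → ℝ) (N : E → ℝ) (k : E → E) : ℝ :=
  -∫ x in Ω, N x * ω (k x)

/-- The wave Hamiltonian in Lie–Poisson variables, `H_W(p / N, N) = - ∫ N ω(p / N) d³x`. -/
def waveHamLP (Ω : Set E) (ω : E → ℝ) (p : E → E) (N : E → ℝ) : ℝ :=
  waveHam Ω ω N (fun x => (N x)⁻¹ • p x)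

/-- Hamiltonian of the waves carried by a current `u`: `∫ p · u d³x - H_W(p / N, N)`. -/
def boostedWaveHam (Ω : Set E) (ω : E → ℝ) (u : E → E) (p : E → E) (N : E → ℝ) : ℝ :=
  (∫ x in Ω, ⟪p x, u x⟫) - waveHamLP Ω ω p N

/-- `i`-th component of the Lie transport of a momentum density by the velocity `u`:
`(∂ₜ m + (u · ∇) m + (∇u)ᵀ · m + m div u)ᵢ`. -/
def momTransport (u m : ℝ → E → E) (t : ℝ) (x : E) (i : Fin 3) : ℝ :=
  deriv (fun τ => m τ x i) t
    + ∑ j, (u t x j * pd j (fun y => m t y i) x + m t x j * pd i (fun y => u t y j) x)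
    + m t x i * dvg (u t) x

/-- Bernoulli function `π = ½|u|² + R · u - g b z - pr`, with `pr` the pressure. -/
def bernoulli (g : ℝ) (R : E → E) (u : ℝ → E → E) (b pr : ℝ → E → ℝ) (t : ℝ) (x : E) : ℝ :=
  ‖u t x‖ ^ 2 / 2 + ⟪R x, u t x⟫ - g * b t x * x 2 - pr t x

/-- Momentum density `D (u + R)` of the current alone. -/
def currentMom (R : E → E) (u : ℝ → E → E) (D : ℝ → E → ℝ) (t : ℝ) (x : E) : E :=
  D t x • (u t x + R x)

/-- `i`-th component of the force `D ∇π + D g z ∇b`. -/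
def fluidForce (g : ℝ) (R : E → E) (u : ℝ → E → E) (D b pr : ℝ → E → ℝ)
    (t : ℝ) (x : E) (i : Fin 3) : ℝ :=
  D t x * pd i (bernoulli g R u b pr t) x + D t x * g * x 2 * pd i (b t) x

/-- The transport equations `∂ₜD + div(D u) = 0`, `D = 1`, `∂ₜb + u · ∇b = 0`. -/
structure IsTransported (I : Set ℝ) (Ω : Set E) (u : ℝ → E → E) (D b : ℝ → E → ℝ) : Prop where
  mass : ∀ t ∈ I, ∀ x ∈ Ω,
    deriv (fun τ => D τ x) t + dvg (fun y => D t y • u t y) x = 0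
  incompressible : ∀ t ∈ I, ∀ x ∈ Ω, D t x = 1
  buoyancy : ∀ t ∈ I, ∀ x ∈ Ω,
    deriv (fun τ => b τ x) t + ∑ j, u t x j * pd j (b t) x = 0

/-- The wave–current equations with wave Hamiltonian functional `H = H(N, k)`. The fields `A` and
`B` are `δH/δN` (at fixed `k`) and `δH/δk` (at fixed `N`), evaluated at `k = ∇φ`; the momentum
density is `m = D (u + R) - N ∇φ`; `s` is the coefficient of the wave force in the motion
equation. -/
def IsWaveCurrent (I : Set ℝ) (Ω : Set E) (g : ℝ) (R : E → E)
    (H : (E → ℝ) → (E → E) → ℝ) (s : ℝ)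
    (u : ℝ → E → E) (D b φ N pr : ℝ → E → ℝ) : Prop :=
  ∃ (A : ℝ → E → ℝ) (B : ℝ → E → E),
    (∀ t ∈ I, ContDiffOn ℝ 1 (A t) Ω ∧ ContDiffOn ℝ 1 (B t) Ω ∧
      HasVarDeriv Ω (fun N' => H N' (waveVec φ t)) (N t) (A t) ∧
      HasVarDeriv Ω (fun k' => H (N t) k') (waveVec φ t) (B t)) ∧
    (∀ t ∈ I, ∀ x ∈ Ω, ∀ i,
      momTransport u (fun t x => currentMom R u D t x - pseudomom N φ t x) t x i
        = fluidForce g R u D b pr t x i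
          + s * (waveVec φ t x i * dvg (B t) x + N t x * pd i (A t) x)) ∧
    IsTransported I Ω u D b ∧
    (∀ t ∈ I, ∀ x ∈ Ω,
      deriv (fun τ => φ τ x) t + ⟪u t x, waveVec φ t x⟫ - A t x = 0) ∧
    (∀ t ∈ I, ∀ x ∈ Ω,
      deriv (fun τ => N τ x) t + dvg (fun y => N t y • u t y) x - dvg (B t) x = 0)

/-- `j`-th momentum component of the Lie–Poisson operator of `𝔛 ⋉ C^∞` at `(p, N)`, applied to
`(ξ, σ)`: `∑ₖ (pₖ ∂ⱼ + ∂ₖ pⱼ) ξᵏ + N ∂ⱼ σ`. -/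
def lpMom (p : E → E) (N : E → ℝ) (ξ : E → E) (σ : E → ℝ) (x : E) (j : Fin 3) : ℝ :=
  ∑ k, (p x k * pd j (fun y => ξ y k) x + pd k (fun y => p y j * ξ y k) x) + N x * pd j σ x

/-- Density component of the same operator: `∑ₖ ∂ₖ (N ξᵏ)`. -/
def lpDens (N : E → ℝ) (ξ : E → E) (x : E) : ℝ := ∑ k, pd k (fun y => N y * ξ y k) x

/-- `u + v_G(p / N)`. -/
def lpVel (ω : E → ℝ) (u : E → E) (p : E → E) (N : E → ℝ) (x : E) : E :=
  u x + groupVel ω ((N x)⁻¹ • p x)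

/-- `ω(p / N) - N⁻¹ p · v_G(p / N)`. -/
def lpFreq (ω : E → ℝ) (p : E → E) (N : E → ℝ) (x : E) : ℝ :=
  ω ((N x)⁻¹ • p x) - (N x)⁻¹ * ⟪p x, groupVel ω ((N x)⁻¹ • p x)⟫

/-- `i`-th component of `(p / N) div(N v_G(p / N)) + N ∇ω(p / N)`. -/
def waveForce (ω : E → ℝ) (p : E → E) (N : E → ℝ) (x : E) (i : Fin 3) : ℝ :=
  ((N x)⁻¹ • p x) i * dvg (fun y => N y • groupVel ω ((N y)⁻¹ • p y)) x
    + N x * pd i (fun y => ω ((N y)⁻¹ • p y)) x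

/-- The closed generalised-Lagrangian-mean system for the Euler–Boussinesq fluid, in the variables
`(u, D, b, pr, p, N)` only: the motion equation for `D (u + R) - p`, the transport equations, and
the Lie–Poisson equations of the wave variables `(p, N)`. -/
structure IsClosedGLM (I : Set ℝ) (Ω : Set E) (g : ℝ) (R : E → E) (ω : E → ℝ) (s : ℝ)
    (u : ℝ → E → E) (D b pr : ℝ → E → ℝ) (p : ℝ → E → E) (N : ℝ → E → ℝ) : Prop where
  motion : ∀ t ∈ I, ∀ x ∈ Ω, ∀ i,
    momTransport u (fun t x => currentMom R u D t x - p t x) t x i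
      = fluidForce g R u D b pr t x i - s * waveForce ω (p t) (N t) x i
  transport : IsTransported I Ω u D b
  wave_momentum : ∀ t ∈ I, ∀ x ∈ Ω, ∀ j,
    deriv (fun τ => p τ x j) t
      = -lpMom (p t) (N t) (lpVel ω (u t) (p t) (N t)) (lpFreq ω (p t) (N t)) x j
  wave_action : ∀ t ∈ I, ∀ x ∈ Ω,
    deriv (fun τ => N τ x) t = -lpDens (N t) (lpVel ω (u t) (p t) (N t)) x

/-- Weak pairing of `(p, N)` with the bracket of `𝔛 ⋉ C^∞`,
`[(ξ, σ), (η, τ)] = ([ξ, η], ξ · ∇τ - η · ∇σ)`. -/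
def sdPairing (Ω : Set E) (p : E → E) (N : E → ℝ) (ξ : E → E) (σ : E → ℝ)
    (η : E → E) (τ : E → ℝ) : ℝ :=
  ∫ x in Ω, (⟪p x, VectorField.lieBracket ℝ ξ η x⟫
    + N x * (fderiv ℝ τ x (ξ x) - fderiv ℝ σ x (η x)))

end WCI

end

open Filter Topology

namespace WCI

/-! Two analytic facts handle the functionals. A compactly supported variation changes the integrand
only over a compact K ⊆ Ω, so integrability of the unperturbed density suffices to differentiate
under the integral (`hasDerivAt_setIntegral_of_compact_perturbation`); the formulas for δH_W and δℋ
are then the chain rule. Conversely, continuous variational derivatives are unique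
(`HasVarDeriv.eqOn`), so those in the wave–current equations must be -ω(k) and -N v_G(k).

The rest is algebra with the curl-free field k = ∇φ. At p = Nk, the Lie–Poisson operator applied to
(u + v_G, ω - k·v_G) has momentum component k div(N(u + v_G)) + N∇(u·k + ω), because curl-freeness
merges (u + v_G)·∇k and the gradients of u + v_G into ∇((u + v_G)·k). Since ∂ₜk = ∇∂ₜφ, the defect
of the wave momentum equation is k a + N∇f, where a is the defect of the action equation and f = ∂ₜφ
+ u·k + ω(k) (`deriv_pseudomom_add_lpMom`). If a = 0 and f = 0, the momentum equation follows, which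
gives the equivalence with the closed system. If instead both wave equations hold, then N ≠ 0 forces
∇f = 0, so f depends on t only when Ω is connected.

The same operator also expands as transport of p by u plus F_W, so the wave momentum equation is
M(p) = -F_W (`momTransport_pseudomom_add_waveForce`); adding it to the equation for M(m) produces
the coefficient 1 + s. The weak Lie–Poisson form holds because the two integrands differ by total
derivatives of functions compactly supported in Ω (`integral_lpMom_lpDens_test`). -/

/-! ### Integrals perturbed over a compact set. -/

/-- Regularity is only known inside Ω; vanishing off K makes h globally continuous, since it is
locally zero off its support. -/
lemma integrable_of_eq_zero_off_compact {Ω K : Set E} (hΩ : IsOpen Ω) (hK : IsCompact K)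
    (hKΩ : K ⊆ Ω) {h : E → ℝ} (hc : ContinuousOn h Ω) (h0 : ∀ x, x ∉ K → h x = 0) :
    Integrable h := by
  have hs : tsupport h ⊆ K :=
    closure_minimal (fun x hx => by_contra fun hxK => hx (h0 x hxK)) hK.isClosed
  have hcont : Continuous h := continuous_of_tsupport fun x hx =>
    hc.continuousAt (hΩ.mem_nhds (hKΩ (hs hx)))
  exact hcont.integrable_of_hasCompactSupport
    (HasCompactSupport.of_support_subset_isCompact hK ((subset_tsupport h).trans hs))

lemma setIntegral_eq_integral_of_eq_zero_off {Ω K : Set E} (hKΩ : K ⊆ Ω) {h : E → ℝ}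
    (h0 : ∀ x, x ∉ K → h x = 0) : ∫ x in Ω, h x = ∫ x, h x :=
  setIntegral_eq_integral_of_forall_compl_eq_zero fun x hx => h0 x fun hxK => hx (hKΩ hxK)

/-- Differentiation under the integral sign for an integrand that depends on the parameter only
over a compact set. -/
lemma hasDerivAt_setIntegral_of_compact_perturbation {Ω K : Set E} (hΩ : IsOpen Ω)
    (hK : IsCompact K) (hKΩ : K ⊆ Ω) {W : Set (ℝ × E)} (hW : IsOpen W)
    (hKW : ∀ x ∈ K, ((0 : ℝ), x) ∈ W) {G G' : ℝ → E → ℝ}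
    (hG : ContinuousOn (fun q : ℝ × E => G q.1 q.2) W)
    (hG' : ContinuousOn (fun q : ℝ × E => G' q.1 q.2) W)
    (hd : ∀ ε x, (ε, x) ∈ W → HasDerivAt (fun e => G e x) (G' ε x) ε)
    (hint : IntegrableOn (G 0) Ω)
    (hoff : ∀ ε x, x ∉ K → G ε x = G 0 x) (hoff' : ∀ x, x ∉ K → G' 0 x = 0) :
    HasDerivAt (fun ε => ∫ x in Ω, G ε x) (∫ x in Ω, G' 0 x) 0 := by
  -- The domain W need not be a product. Compactness of K gives one range of ε valid for all x ∈ K;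
  -- halving δ leaves a compact parameter interval, on which G' has a uniform bound.
  obtain ⟨A, B, hA, hB, h0A, hKB, hAB⟩ := generalized_tube_lemma (isCompact_singleton (x := (0 : ℝ)))
    hK hW (by rintro ⟨a, x⟩ ⟨ha, hx⟩; obtain rfl : a = 0 := ha; exact hKW x hx)
  obtain ⟨δ, hδ, hball⟩ := Metric.isOpen_iff.1 hA 0 (h0A rfl)
  have hsub : Metric.closedBall (0 : ℝ) (δ / 2) ×ˢ K ⊆ W := fun q hq =>
    hAB ⟨hball (Metric.closedBall_subset_ball (by linarith) hq.1), hKB hq.2⟩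
  obtain ⟨C, hC⟩ := ((isCompact_closedBall (0 : ℝ) (δ / 2)).prod hK).exists_bound_of_continuousOn
    (hG'.mono hsub)
  have hnhds : Metric.closedBall (0 : ℝ) (δ / 2) ∈ 𝓝 (0 : ℝ) :=
    Metric.closedBall_mem_nhds _ (by linarith)
  have hslice : ∀ {F : ℝ → E → ℝ}, ContinuousOn (fun q : ℝ × E => F q.1 q.2) W →
      ∀ ε ∈ Metric.closedBall (0 : ℝ) (δ / 2), ContinuousOn (F ε) K := fun hF ε hε =>
    hF.comp (f := fun x => (ε, x)) (by fun_prop) fun x hx => hsub ⟨hε, hx⟩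
  have h0 : (0 : ℝ) ∈ Metric.closedBall (0 : ℝ) (δ / 2) := mem_of_mem_nhds hnhds
  have key := (hasDerivAt_integral_of_dominated_loc_of_deriv_le (μ := volume.restrict K)
    (F := G) (F' := G') (x₀ := (0 : ℝ)) (bound := fun _ => C) hnhds
    (by
      filter_upwards [hnhds] with ε hε
      exact (hslice hG ε hε).aestronglyMeasurable hK.measurableSet)
    ((hslice hG 0 h0).integrableOn_compact hK)
    ((hslice hG' 0 h0).aestronglyMeasurable hK.measurableSet)
    (by
      filter_upwards [ae_restrict_mem hK.measurableSet] with x hx ε hε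
      exact hC (ε, x) ⟨hε, hx⟩)
    (by
      have : IsFiniteMeasure (volume.restrict K) := ⟨by simpa using hK.measure_lt_top⟩
      exact integrable_const C)
    (by
      filter_upwards [ae_restrict_mem hK.measurableSet] with x hx ε hε
      exact hd ε x (hsub ⟨hε, hx⟩))).2
  -- Off K the integrand is frozen at ε = 0, so that part of the integral is a constant and
  -- contributes nothing to the derivative.
  have hsplit : ∀ ε ∈ Metric.closedBall (0 : ℝ) (δ / 2),
      ∫ x in Ω, G ε x = (∫ x in K, G ε x) + ∫ x in Ω \ K, G 0 x := by
    intro ε hε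
    have hoffΩ : EqOn (G 0) (G ε) (Ω \ K) := fun x hx => (hoff ε x hx.2).symm
    have hm := hΩ.measurableSet.diff hK.measurableSet
    have := setIntegral_union (μ := volume) (f := G ε) (disjoint_sdiff_self_right (x := K) (y := Ω)) hm
      ((hslice hG ε hε).integrableOn_compact hK)
      ((hint.mono_set sdiff_subset).congr_fun hoffΩ hm)
    rw [union_sdiff_cancel hKΩ] at this
    rw [this, setIntegral_congr_fun hm hoffΩ]
  have hlim : ∫ x in Ω, G' 0 x = ∫ x in K, G' 0 x :=
    setIntegral_eq_of_subset_of_forall_sdiff_eq_zero hΩ.measurableSet hKΩ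
      fun x hx => hoff' x hx.2
  rw [hlim]
  refine (key.add_const (∫ x in Ω \ K, G 0 x)).congr_of_eventuallyEq ?_
  filter_upwards [hnhds] with ε hε using hsplit ε hε

/-! ### Calculus and uniqueness of variational derivatives. -/

section VarDeriv

variable {V : Type} [NormedAddCommGroup V] [InnerProductSpace ℝ V]

lemma integrable_inner_test {Ω : Set E} (hΩ : IsOpen Ω) {g η : E → V} (hg : ContinuousOn g Ω)
    (hη : Continuous η) (hc : HasCompactSupport η) (hs : tsupport η ⊆ Ω) :
    Integrable (fun x => ⟪g x, η x⟫) :=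
  integrable_of_eq_zero_off_compact hΩ hc hs (hg.inner hη.continuousOn) fun x hx => by
    rw [image_eq_zero_of_notMem_tsupport hx, inner_zero_right]

lemma HasVarDeriv.sub {Ω : Set E} (hΩ : IsOpen Ω) {F₁ F₂ : (E → V) → ℝ} {f g₁ g₂ : E → V}
    (h₁ : HasVarDeriv Ω F₁ f g₁) (h₂ : HasVarDeriv Ω F₂ f g₂) (hg₁ : ContinuousOn g₁ Ω)
    (hg₂ : ContinuousOn g₂ Ω) :
    HasVarDeriv Ω (fun f => F₁ f - F₂ f) f (fun x => g₁ x - g₂ x) := by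
  intro η hη hc hs
  refine ((h₁ η hη hc hs).sub (h₂ η hη hc hs)).congr_deriv ?_
  rw [← integral_sub (integrable_inner_test hΩ hg₁ hη.continuous hc hs).integrableOn
    (integrable_inner_test hΩ hg₂ hη.continuous hc hs).integrableOn]
  simp only [inner_sub_left]

lemma HasVarDeriv.const_sub {Ω : Set E} {F : (E → V) → ℝ} {f g : E → V} (c : ℝ)
    (h : HasVarDeriv Ω F f g) : HasVarDeriv Ω (fun f => c - F f) f (fun x => -g x) := by
  intro η hη hc hs
  refine ((h η hη hc hs).const_sub c).congr_deriv ?_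
  simp only [inner_neg_left, integral_neg]

lemma HasVarDeriv.neg {Ω : Set E} {F : (E → V) → ℝ} {f g : E → V}
    (h : HasVarDeriv Ω F f g) : HasVarDeriv Ω (fun f => -F f) f (fun x => -g x) := by
  intro η hη hc hs
  refine (h η hη hc hs).neg.congr_deriv ?_
  simp only [inner_neg_left, integral_neg]

lemma HasVarDeriv.congr_right {Ω : Set E} (hΩ : IsOpen Ω) {F : (E → V) → ℝ} {f g₁ g₂ : E → V}
    (h : HasVarDeriv Ω F f g₁) (hg : EqOn g₁ g₂ Ω) : HasVarDeriv Ω F f g₂ := by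
  intro η hη hc hs
  refine (h η hη hc hs).congr_deriv (setIntegral_congr_fun hΩ.measurableSet fun x hx => ?_)
  simp only [hg hx]

/-- Continuous variational derivatives are unique. -/
lemma HasVarDeriv.eqOn [CompleteSpace V] {Ω : Set E} (hΩ : IsOpen Ω) {F : (E → V) → ℝ}
    {f g₁ g₂ : E → V}
    (h₁ : HasVarDeriv Ω F f g₁) (h₂ : HasVarDeriv Ω F f g₂) (hg₁ : ContinuousOn g₁ Ω)
    (hg₂ : ContinuousOn g₂ Ω) : EqOn g₁ g₂ Ω := by
  have hd : ContinuousOn (fun x => g₁ x - g₂ x) Ω := hg₁.sub hg₂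
  -- Test with θ v for scalar θ and fixed v: this reduces the vector case to the scalar fundamental
  -- lemma of the calculus of variations, and continuity upgrades a.e. vanishing to vanishing on Ω.
  have hweak : ∀ v : V, EqOn (fun x => ⟪g₁ x - g₂ x, v⟫) (fun _ => (0 : ℝ)) Ω := by
    intro v
    have hcv : ContinuousOn (fun x => ⟪g₁ x - g₂ x, v⟫) Ω := hd.inner continuousOn_const
    have hae := hΩ.ae_eq_zero_of_integral_contDiff_smul_eq_zero (μ := volume)
      (f := fun x => ⟪g₁ x - g₂ x, v⟫) (hcv.locallyIntegrableOn hΩ.measurableSet)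
      (fun θ hθ hc hs => by
        have hsupp : tsupport (fun x => θ x • v) ⊆ tsupport θ := tsupport_smul_subset_left θ _
        have hη : ContDiff ℝ (⊤ : ℕ∞) (fun x => θ x • v) := hθ.smul contDiff_const
        have hηc : HasCompactSupport (fun x => θ x • v) := hc.smul_right
        have huniq := (h₁ _ hη hηc (hsupp.trans hs)).unique (h₂ _ hη hηc (hsupp.trans hs))
        rw [← sub_eq_zero, ← integral_sub
          (integrable_inner_test hΩ hg₁ hη.continuous hηc (hsupp.trans hs)).integrableOn
          (integrable_inner_test hΩ hg₂ hη.continuous hηc (hsupp.trans hs)).integrableOn] at huniq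
        rw [← setIntegral_eq_integral_of_eq_zero_off hs fun x hx => by
          rw [image_eq_zero_of_notMem_tsupport hx, zero_smul], ← huniq]
        refine integral_congr_ae (Eventually.of_forall fun x => ?_)
        simp only [inner_sub_left, inner_smul_right, smul_eq_mul]
        ring)
    exact Measure.eqOn_open_of_ae_eq ((ae_restrict_iff' hΩ.measurableSet).2 hae) hΩ hcv
      continuousOn_const
  intro x hx
  have := hweak (g₁ x - g₂ x) hx
  exact sub_eq_zero.1 (inner_self_eq_zero.1 this)

end VarDeriv

/-! ### Variational derivatives of the wave Hamiltonian. -/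

section WaveHamiltonian

variable {Ω U : Set E} {ω : E → ℝ} {n : E → ℝ} {κ : E → E}

lemma hasGradientAt_dispersion (hU : IsOpen U) (hω : ContDiffOn ℝ 2 ω U) {k : E} (hk : k ∈ U) :
    HasGradientAt ω (groupVel ω k) k :=
  ((hω.contDiffAt (hU.mem_nhds hk)).differentiableAt (by norm_num)).hasGradientAt

lemma contDiffOn_groupVel (hU : IsOpen U) (hω : ContDiffOn ℝ 2 ω U) :
    ContDiffOn ℝ 1 (groupVel ω) U :=
  (InnerProductSpace.toDual ℝ E).symm.toContinuousLinearEquiv.contDiff.comp_contDiffOn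
    (hω.fderiv_of_isOpen hU (by norm_num))

lemma hasDerivAt_dispersion_comp (hU : IsOpen U) (hω : ContDiffOn ℝ 2 ω U) {c : ℝ → E} {c' : E}
    {ε : ℝ} (hc : HasDerivAt c c' ε) (hm : c ε ∈ U) :
    HasDerivAt (fun e => ω (c e)) ⟪groupVel ω (c ε), c'⟫ ε := by
  have := (hasGradientAt_dispersion hU hω hm).hasFDerivAt.comp_hasDerivAt ε hc
  exact this.congr_deriv (by simp)

lemma hasVarDeriv_waveHam_density (hΩ : IsOpen Ω) (hω : ContDiffOn ℝ 2 ω U)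
    (hn : ContinuousOn n Ω) (hκ : ContinuousOn κ Ω) (hκU : MapsTo κ Ω U)
    (hint : IntegrableOn (fun x => n x * ω (κ x)) Ω) :
    HasVarDeriv Ω (fun N' => waveHam Ω ω N' κ) n (fun x => -ω (κ x)) := by
  refine HasVarDeriv.neg (F := fun N' => ∫ x in Ω, N' x * ω (κ x)) (g := fun x => ω (κ x)) ?_
  intro η hη hc hs
  have h2 : ContinuousOn (fun q : ℝ × E => q.2) (univ ×ˢ Ω) := continuous_snd.continuousOn
  have hm : MapsTo (fun q : ℝ × E => q.2) (univ ×ˢ Ω) Ω := fun q hq => hq.2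
  have hωκ : ContinuousOn (fun q : ℝ × E => ω (κ q.2)) (univ ×ˢ Ω) :=
    (hω.continuousOn.comp hκ hκU).comp h2 hm
  have hηc := hη.continuous
  refine (hasDerivAt_setIntegral_of_compact_perturbation hΩ hc hs
    (G := fun ε x => (n x + ε • η x) * ω (κ x)) (G' := fun _ x => η x * ω (κ x))
    (isOpen_univ.prod hΩ) (fun x hx => ⟨trivial, hs hx⟩)
    (((hn.comp h2 hm).add (by fun_prop)).mul hωκ)
    (ContinuousOn.mul (by fun_prop) hωκ) ?_ (by simpa using hint) ?_ ?_).congr_deriv ?_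
  · intro ε x _
    simpa using (((hasDerivAt_id ε).mul_const (η x)).const_add (n x)).mul_const (ω (κ x))
  · intro ε x hx
    simp [image_eq_zero_of_notMem_tsupport hx]
  · intro x hx
    simp [image_eq_zero_of_notMem_tsupport hx]
  · simp

lemma hasVarDeriv_waveHam_waveVec (hΩ : IsOpen Ω) (hU : IsOpen U) (hω : ContDiffOn ℝ 2 ω U)
    (hn : ContinuousOn n Ω) (hκ : ContinuousOn κ Ω) (hκU : MapsTo κ Ω U)
    (hint : IntegrableOn (fun x => n x * ω (κ x)) Ω) :
    HasVarDeriv Ω (fun k' => waveHam Ω ω n k') κ (fun x => -(n x • groupVel ω (κ x))) := by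
  refine HasVarDeriv.neg (F := fun k' => ∫ x in Ω, n x * ω (k' x))
    (g := fun x => n x • groupVel ω (κ x)) ?_
  intro η hη hc hs
  have h2 : ContinuousOn (fun q : ℝ × E => q.2) (univ ×ˢ Ω) := continuous_snd.continuousOn
  have hm : MapsTo (fun q : ℝ × E => q.2) (univ ×ˢ Ω) Ω := fun q hq => hq.2
  have hηc := hη.continuous
  have hpert : ContinuousOn (fun q : ℝ × E => κ q.2 + q.1 • η q.2) (univ ×ˢ Ω) :=
    (hκ.comp h2 hm).add (by fun_prop)
  have hmU : MapsTo (fun q : ℝ × E => κ q.2 + q.1 • η q.2)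
      ((univ ×ˢ Ω) ∩ (fun q : ℝ × E => κ q.2 + q.1 • η q.2) ⁻¹' U) U := fun q hq => hq.2
  have hn2 := (hn.comp h2 hm).mono
    (inter_subset_left (t := (fun q : ℝ × E => κ q.2 + q.1 • η q.2) ⁻¹' U))
  -- ω is only controlled on U, so the domain is the open set of (ε, x) where the perturbed wave
  -- vector stays in U.
  refine (hasDerivAt_setIntegral_of_compact_perturbation hΩ hc hs
    (G := fun ε x => n x * ω (κ x + ε • η x))
    (G' := fun ε x => n x * ⟪groupVel ω (κ x + ε • η x), η x⟫)
    (hpert.isOpen_inter_preimage (isOpen_univ.prod hΩ) hU)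
    (fun x hx => ⟨⟨trivial, hs hx⟩, by simpa using hκU (hs hx)⟩)
    (hn2.mul (hω.continuousOn.comp (hpert.mono inter_subset_left) hmU))
    (hn2.mul (((contDiffOn_groupVel hU hω).continuousOn.comp
      (hpert.mono inter_subset_left) hmU).inner (by fun_prop)))
    ?_ (by simpa using hint) ?_ ?_).congr_deriv ?_
  · rintro ε x ⟨-, hx⟩
    have hcurve : HasDerivAt (fun e : ℝ => κ x + e • η x) (η x) ε := by
      simpa using ((hasDerivAt_id ε).smul_const (η x)).const_add (κ x)
    exact (hasDerivAt_dispersion_comp hU hω hcurve hx).const_mul (n x)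
  · intro ε x hx
    simp [image_eq_zero_of_notMem_tsupport hx]
  · intro x hx
    simp [image_eq_zero_of_notMem_tsupport hx]
  · simp [inner_smul_left]

variable {p : E → E}

lemma hasVarDeriv_waveHamLP_momentum (hΩ : IsOpen Ω) (hU : IsOpen U) (hω : ContDiffOn ℝ 2 ω U)
    (hn : ContinuousOn n Ω) (hn0 : ∀ x ∈ Ω, n x ≠ 0) (hp : ContinuousOn p Ω)
    (hpU : MapsTo (fun x => (n x)⁻¹ • p x) Ω U)
    (hint : IntegrableOn (fun x => n x * ω ((n x)⁻¹ • p x)) Ω) :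
    HasVarDeriv Ω (fun p' => waveHamLP Ω ω p' n) p
      (fun x => -groupVel ω ((n x)⁻¹ • p x)) := by
  refine HasVarDeriv.neg (F := fun p' => ∫ x in Ω, n x * ω ((n x)⁻¹ • p' x))
    (g := fun x => groupVel ω ((n x)⁻¹ • p x)) ?_
  intro η hη hc hs
  have h2 : ContinuousOn (fun q : ℝ × E => q.2) (univ ×ˢ Ω) := continuous_snd.continuousOn
  have hm : MapsTo (fun q : ℝ × E => q.2) (univ ×ˢ Ω) Ω := fun q hq => hq.2
  have hηc := hη.continuous
  have hpert : ContinuousOn (fun q : ℝ × E => (n q.2)⁻¹ • (p q.2 + q.1 • η q.2)) (univ ×ˢ Ω) :=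
    ((hn.inv₀ hn0).comp h2 hm).smul ((hp.comp h2 hm).add (by fun_prop))
  have hmU : MapsTo (fun q : ℝ × E => (n q.2)⁻¹ • (p q.2 + q.1 • η q.2))
      ((univ ×ˢ Ω) ∩ (fun q : ℝ × E => (n q.2)⁻¹ • (p q.2 + q.1 • η q.2)) ⁻¹' U) U :=
    fun q hq => hq.2
  have hn2 := (hn.comp h2 hm).mono
    (inter_subset_left (t := (fun q : ℝ × E => (n q.2)⁻¹ • (p q.2 + q.1 • η q.2)) ⁻¹' U))
  refine (hasDerivAt_setIntegral_of_compact_perturbation hΩ hc hs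
    (G := fun ε x => n x * ω ((n x)⁻¹ • (p x + ε • η x)))
    (G' := fun ε x => ⟪groupVel ω ((n x)⁻¹ • (p x + ε • η x)), η x⟫)
    (hpert.isOpen_inter_preimage (isOpen_univ.prod hΩ) hU)
    (fun x hx => ⟨⟨trivial, hs hx⟩, by simpa using hpU (hs hx)⟩)
    (hn2.mul (hω.continuousOn.comp (hpert.mono inter_subset_left) hmU))
    (((contDiffOn_groupVel hU hω).continuousOn.comp
      (hpert.mono inter_subset_left) hmU).inner (by fun_prop))
    ?_ (by simpa using hint) ?_ ?_).congr_deriv ?_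
  · rintro ε x ⟨⟨-, hxΩ⟩, hx⟩
    have hcurve : HasDerivAt (fun e : ℝ => (n x)⁻¹ • (p x + e • η x)) ((n x)⁻¹ • η x) ε := by
      have h := (((hasDerivAt_id ε).smul_const (η x)).const_add (p x)).const_smul (n x)⁻¹
      rw [one_smul] at h
      exact h
    refine ((hasDerivAt_dispersion_comp hU hω hcurve hx).const_mul (n x)).congr_deriv ?_
    -- The weight N cancels the factor N⁻¹ from the chain rule.
    rw [inner_smul_right, mul_inv_cancel_left₀ (hn0 x hxΩ)]
  · intro ε x hx
    simp [image_eq_zero_of_notMem_tsupport hx]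
  · intro x hx
    simp [image_eq_zero_of_notMem_tsupport hx]
  · simp

/-- At fixed p the density enters twice: as weight, giving ω, and through the wave vector p/N, whose
derivative -p/N² gives -N⁻¹ p·v_G. -/
lemma hasVarDeriv_waveHamLP_density (hΩ : IsOpen Ω) (hU : IsOpen U) (hω : ContDiffOn ℝ 2 ω U)
    (hn : ContinuousOn n Ω) (hn0 : ∀ x ∈ Ω, n x ≠ 0) (hp : ContinuousOn p Ω)
    (hpU : MapsTo (fun x => (n x)⁻¹ • p x) Ω U)
    (hint : IntegrableOn (fun x => n x * ω ((n x)⁻¹ • p x)) Ω) :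
    HasVarDeriv Ω (fun N' => waveHamLP Ω ω p N') n (fun x => -lpFreq ω p n x) := by
  refine HasVarDeriv.neg (F := fun N' => ∫ x in Ω, N' x * ω ((N' x)⁻¹ • p x))
    (g := fun x => lpFreq ω p n x) ?_
  intro η hη hc hs
  have h2 : ContinuousOn (fun q : ℝ × E => q.2) (univ ×ˢ Ω) := continuous_snd.continuousOn
  have hm : MapsTo (fun q : ℝ × E => q.2) (univ ×ˢ Ω) Ω := fun q hq => hq.2
  have hηc := hη.continuous
  have hden : ContinuousOn (fun q : ℝ × E => n q.2 + q.1 • η q.2) (univ ×ˢ Ω) :=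
    (hn.comp h2 hm).add (by fun_prop)
  -- The perturbed density must be kept away from zero before it can be inverted; W then also keeps
  -- the wave vector in U.
  let S : Set (ℝ × E) := (univ ×ˢ Ω) ∩ (fun q : ℝ × E => n q.2 + q.1 • η q.2) ⁻¹' {0}ᶜ
  have hS : IsOpen S := hden.isOpen_inter_preimage (isOpen_univ.prod hΩ) isOpen_compl_singleton
  have hinv : ContinuousOn (fun q : ℝ × E => (n q.2 + q.1 • η q.2)⁻¹) S :=
    (hden.mono inter_subset_left).inv₀ fun q hq => hq.2
  have hp2 : ContinuousOn (fun q : ℝ × E => p q.2) S := (hp.comp h2 hm).mono inter_subset_left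
  have hpert : ContinuousOn (fun q : ℝ × E => (n q.2 + q.1 • η q.2)⁻¹ • p q.2) S := hinv.smul hp2
  let W : Set (ℝ × E) := S ∩ (fun q : ℝ × E => (n q.2 + q.1 • η q.2)⁻¹ • p q.2) ⁻¹' U
  have hWS : W ⊆ S := inter_subset_left
  have hmU : MapsTo (fun q : ℝ × E => (n q.2 + q.1 • η q.2)⁻¹ • p q.2) W U := fun q hq => hq.2
  have hωc := hω.continuousOn.comp (hpert.mono hWS) hmU
  refine (hasDerivAt_setIntegral_of_compact_perturbation hΩ hc hs
    (G := fun ε x => (n x + ε • η x) * ω ((n x + ε • η x)⁻¹ • p x))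
    (G' := fun ε x => η x * (ω ((n x + ε • η x)⁻¹ • p x)
      - (n x + ε • η x)⁻¹ * ⟪p x, groupVel ω ((n x + ε • η x)⁻¹ • p x)⟫))
    (W := W) (hpert.isOpen_inter_preimage hS hU)
    (fun x hx => ⟨⟨⟨trivial, hs hx⟩, by simpa using hn0 x (hs hx)⟩, by simpa using hpU (hs hx)⟩)
    (((hden.mono inter_subset_left).mono hWS).mul hωc)
    (ContinuousOn.mul (by fun_prop) (hωc.sub ((hinv.mono hWS).mul ((hp2.mono hWS).inner
      ((contDiffOn_groupVel hU hω).continuousOn.comp (hpert.mono hWS) hmU)))))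
    ?_ (by simpa using hint) ?_ ?_).congr_deriv ?_
  · rintro ε x ⟨⟨-, hx0⟩, hx⟩
    have hx0' : n x + ε • η x ≠ 0 := hx0
    have hlin : HasDerivAt (fun e : ℝ => n x + e • η x) (η x) ε := by
      simpa using ((hasDerivAt_id ε).smul_const (η x)).const_add (n x)
    have hcurve := (hlin.inv hx0').smul_const (p x)
    refine (hlin.mul (hasDerivAt_dispersion_comp hU hω hcurve hx)).congr_deriv ?_
    rw [inner_smul_right, real_inner_comm]
    simp only [Pi.inv_apply]
    field_simp
    ring
  · intro ε x hx
    simp [image_eq_zero_of_notMem_tsupport hx]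
  · intro x hx
    simp [image_eq_zero_of_notMem_tsupport hx]
  · simp [lpFreq]

lemma hasVarDeriv_inner {u : E → E} (hΩ : IsOpen Ω) (hp : ContinuousOn p Ω)
    (hu : ContinuousOn u Ω) (hint : IntegrableOn (fun x => ⟪p x, u x⟫) Ω) :
    HasVarDeriv Ω (fun p' => ∫ x in Ω, ⟪p' x, u x⟫) p u := by
  intro η hη hc hs
  have h2 : ContinuousOn (fun q : ℝ × E => q.2) (univ ×ˢ Ω) := continuous_snd.continuousOn
  have hm : MapsTo (fun q : ℝ × E => q.2) (univ ×ˢ Ω) Ω := fun q hq => hq.2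
  have hηc := hη.continuous
  have hu2 := hu.comp h2 hm
  refine (hasDerivAt_setIntegral_of_compact_perturbation hΩ hc hs
    (G := fun ε x => ⟪p x + ε • η x, u x⟫) (G' := fun _ x => ⟪η x, u x⟫)
    (isOpen_univ.prod hΩ) (fun x hx => ⟨trivial, hs hx⟩)
    (((hp.comp h2 hm).add (by fun_prop)).inner hu2)
    (ContinuousOn.inner (by fun_prop) hu2) ?_ (by simpa using hint) ?_ ?_).congr_deriv ?_
  · intro ε x _
    simp only [inner_add_left, inner_smul_left]
    simpa using ((hasDerivAt_id ε).mul_const ⟪η x, u x⟫).const_add ⟪p x, u x⟫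
  · intro ε x hx
    simp [image_eq_zero_of_notMem_tsupport hx]
  · intro x hx
    simp [image_eq_zero_of_notMem_tsupport hx]
  · simp only [real_inner_comm]

end WaveHamiltonian

/-! ### Rules for partial derivatives and divergence. -/

section PartialDerivatives

variable {f g : E → ℝ} {x : E}

lemma pd_congr (h : f =ᶠ[𝓝 x] g) (i : Fin 3) : pd i f x = pd i g x := by
  rw [pd, pd, h.fderiv_eq]

lemma pd_add (i : Fin 3) (hf : DifferentiableAt ℝ f x) (hg : DifferentiableAt ℝ g x) :
    pd i (fun y => f y + g y) x = pd i f x + pd i g x := by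
  simp only [pd]
  rw [fderiv_fun_add hf hg]
  rfl

lemma pd_sub (i : Fin 3) (hf : DifferentiableAt ℝ f x) (hg : DifferentiableAt ℝ g x) :
    pd i (fun y => f y - g y) x = pd i f x - pd i g x := by
  simp only [pd]
  rw [fderiv_fun_sub hf hg]
  rfl

lemma pd_neg (i : Fin 3) : pd i (fun y => -f y) x = -pd i f x := by
  simp only [pd]
  rw [fderiv_fun_neg]
  rfl

lemma pd_mul (i : Fin 3) (hf : DifferentiableAt ℝ f x) (hg : DifferentiableAt ℝ g x) :
    pd i (fun y => f y * g y) x = f x * pd i g x + g x * pd i f x := by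
  simp only [pd]
  rw [fderiv_fun_mul hf hg]
  rfl

lemma differentiableAt_apply {F : E → E} (hF : DifferentiableAt ℝ F x) (i : Fin 3) :
    DifferentiableAt ℝ (fun y => F y i) x :=
  (differentiableAt_piLp 2).1 hF i

lemma dvg_congr {F G : E → E} (h : F =ᶠ[𝓝 x] G) : dvg F x = dvg G x :=
  Finset.sum_congr rfl fun i _ => pd_congr (h.mono fun y hy => by simp only [hy]) i

lemma dvg_add {F G : E → E} (hF : DifferentiableAt ℝ F x) (hG : DifferentiableAt ℝ G x) :
    dvg (fun y => F y + G y) x = dvg F x + dvg G x := by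
  simp only [dvg, PiLp.add_apply]
  rw [← Finset.sum_add_distrib]
  exact Finset.sum_congr rfl fun i _ =>
    pd_add i (differentiableAt_apply hF i) (differentiableAt_apply hG i)

lemma dvg_neg {F : E → E} : dvg (fun y => -F y) x = -dvg F x := by
  simp only [dvg, PiLp.neg_apply, pd_neg, Finset.sum_neg_distrib]

lemma inner_eq_sum (a c : E) : ⟪a, c⟫ = ∑ i, a i * c i := by
  simp [PiLp.inner_apply, mul_comm]

lemma gradient_apply_eq_pd (f : E → ℝ) (x : E) (i : Fin 3) : gradient f x i = pd i f x := by
  have h : ⟪gradient f x, EuclideanSpace.single i (1 : ℝ)⟫ = pd i f x := by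
    rw [gradient, InnerProductSpace.toDual_symm_apply, pd]
  rw [← h, EuclideanSpace.inner_single_right]
  simp

lemma fderiv_apply_eq_sum_pd (f : E → ℝ) (x v : E) : fderiv ℝ f x v = ∑ i, v i * pd i f x := by
  have h : ⟪gradient f x, v⟫ = fderiv ℝ f x v := by
    rw [gradient, InnerProductSpace.toDual_symm_apply]
  rw [← h, inner_eq_sum]
  exact Finset.sum_congr rfl fun i _ => by rw [gradient_apply_eq_pd, mul_comm]

lemma fderiv_eq_zero_of_pd (h : ∀ i, pd i f x = 0) : fderiv ℝ f x = 0 := by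
  ext v
  simp [fderiv_apply_eq_sum_pd, h]

lemma fderiv_apply_component {F : E → E} (hF : DifferentiableAt ℝ F x) (v : E) (i : Fin 3) :
    (fderiv ℝ F x v) i = fderiv ℝ (fun y => F y i) x v := by
  have h : HasFDerivAt (fun y => F y i) ((EuclideanSpace.proj i).comp (fderiv ℝ F x)) x :=
    (EuclideanSpace.proj i : E →L[ℝ] ℝ).hasFDerivAt.comp x hF.hasFDerivAt
  rw [h.fderiv]
  rfl

lemma pd_inner {F G : E → E} (i : Fin 3) (hF : DifferentiableAt ℝ F x)
    (hG : DifferentiableAt ℝ G x) :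
    pd i (fun y => ⟪F y, G y⟫) x
      = ∑ k, (F x k * pd i (fun y => G y k) x + G x k * pd i (fun y => F y k) x) := by
  simp only [inner_eq_sum, Fin.sum_univ_three]
  have hF' := differentiableAt_apply hF
  have hG' := differentiableAt_apply hG
  have hFG : ∀ k, DifferentiableAt ℝ (fun y => F y k * G y k) x := fun k => (hF' k).mul (hG' k)
  have h01 : DifferentiableAt ℝ (fun y => F y 0 * G y 0 + F y 1 * G y 1) x :=
    (hFG 0).add (hFG 1)
  rw [pd_add i h01 (hFG 2), pd_add i (hFG 0) (hFG 1), pd_mul i (hF' 0) (hG' 0),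
    pd_mul i (hF' 1) (hG' 1), pd_mul i (hF' 2) (hG' 2)]

end PartialDerivatives

/-! ### The Lie–Poisson operator at a curl-free wave vector. -/

section LiePoissonOperator

variable {n W : E → ℝ} {κ u v : E → E} {x : E}

/-- The operator depends only on germs of ξ and σ; this is needed because (Nκ)/N = κ is available
only where N ≠ 0, that is on Ω. -/
lemma lpMom_congr {p : E → E} {ξ ξ' : E → E} {σ σ' : E → ℝ} (hξ : ξ =ᶠ[𝓝 x] ξ')
    (hσ : σ =ᶠ[𝓝 x] σ') (j : Fin 3) : lpMom p n ξ σ x j = lpMom p n ξ' σ' x j := by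
  have h : ∀ i k, pd i (fun y => ξ y k) x = pd i (fun y => ξ' y k) x := fun i k =>
    pd_congr (hξ.mono fun y hy => by simp only [hy]) i
  have h' : ∀ i k, pd i (fun y => p y j * ξ y k) x = pd i (fun y => p y j * ξ' y k) x :=
    fun i k => pd_congr (hξ.mono fun y hy => by simp only [hy]) i
  simp only [lpMom, h, h', pd_congr hσ]

/-- For a curl-free wave vector `κ`, the momentum component of the Lie–Poisson operator at
`(n κ, n)` is `κ` times its density component plus `n` times the gradient of the Doppler-shifted
frequency. -/
lemma lpMom_eq_lpDens_add (hn : DifferentiableAt ℝ n x) (hW : DifferentiableAt ℝ W x)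
    (hκ : DifferentiableAt ℝ κ x) (hu : DifferentiableAt ℝ u x) (hv : DifferentiableAt ℝ v x)
    (hcurl : ∀ i j, pd i (fun y => κ y j) x = pd j (fun y => κ y i) x) (j : Fin 3) :
    lpMom (fun y => n y • κ y) n (fun y => u y + v y) (fun y => W y - ⟪κ y, v y⟫) x j
      = κ x j * lpDens n (fun y => u y + v y) x + n x * pd j (fun y => ⟪u y, κ y⟫ + W y) x := by
  have hκ' := differentiableAt_apply hκ
  have hu' := differentiableAt_apply hu
  have hv' := differentiableAt_apply hv
  have huv : ∀ k, DifferentiableAt ℝ (fun y => u y k + v y k) x := fun k => (hu' k).add (hv' k)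
  have hnκ : ∀ k, DifferentiableAt ℝ (fun y => n y * κ y k) x := fun k => hn.mul (hκ' k)
  simp only [lpMom, lpDens, PiLp.add_apply, PiLp.smul_apply, smul_eq_mul]
  rw [pd_sub j hW (hκ.inner ℝ hv), pd_add j (hu.inner ℝ hκ) hW, pd_inner j hκ hv,
    pd_inner j hu hκ]
  -- After the product rule, `hcurl` turns each ∂ₖκⱼ into ∂ⱼκₖ; the rest is a polynomial identity.
  simp only [pd_mul _ (hnκ j) (huv _), pd_mul _ hn (huv _), pd_mul _ hn (hκ' _),
    pd_add _ (hu' _) (hv' _), hcurl _ j]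
  simp only [Fin.sum_univ_three]
  ring

/-- For a curl-free wave vector `κ`, the Lie–Poisson operator at `(n κ, n)` splits into transport
of the wave momentum by the current and the wave force. -/
lemma lpMom_eq_transport_add_force (hn : DifferentiableAt ℝ n x) (hW : DifferentiableAt ℝ W x)
    (hκ : DifferentiableAt ℝ κ x) (hu : DifferentiableAt ℝ u x) (hv : DifferentiableAt ℝ v x)
    (hcurl : ∀ i j, pd i (fun y => κ y j) x = pd j (fun y => κ y i) x) (j : Fin 3) :
    lpMom (fun y => n y • κ y) n (fun y => u y + v y) (fun y => W y - ⟪κ y, v y⟫) x j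
      = ∑ k, (u x k * pd k (fun y => (n y • κ y) j) x
            + (n x • κ x) k * pd j (fun y => u y k) x)
        + (n x • κ x) j * dvg u x
        + (κ x j * dvg (fun y => n y • v y) x + n x * pd j W x) := by
  have hκ' := differentiableAt_apply hκ
  have hu' := differentiableAt_apply hu
  have hv' := differentiableAt_apply hv
  have huv : ∀ k, DifferentiableAt ℝ (fun y => u y k + v y k) x := fun k => (hu' k).add (hv' k)
  have hnκ : ∀ k, DifferentiableAt ℝ (fun y => n y * κ y k) x := fun k => hn.mul (hκ' k)
  simp only [lpMom, dvg, PiLp.add_apply, PiLp.smul_apply, smul_eq_mul]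
  rw [pd_sub j hW (hκ.inner ℝ hv), pd_inner j hκ hv]
  simp only [pd_mul _ (hnκ j) (huv _), pd_mul _ hn (hv' _), pd_mul _ hn (hκ' _),
    pd_add _ (hu' _) (hv' _), hcurl _ j]
  simp only [Fin.sum_univ_three]
  ring

end LiePoissonOperator

/-! ### Space–time regularity and mixed derivatives of the phase. -/

section SpaceTime

variable {V : Type*} [NormedAddCommGroup V] [NormedSpace ℝ V] {I : Set ℝ} {Ω : Set E}
  {F : ℝ → E → V} {t : ℝ} {x : E}

lemma contDiffOn_space_slice {m : WithTop ℕ∞}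
    (hF : ContDiffOn ℝ m (fun q : ℝ × E => F q.1 q.2) (I ×ˢ Ω)) (ht : t ∈ I) :
    ContDiffOn ℝ m (F t) Ω :=
  hF.comp (f := fun y => (t, y)) (by fun_prop) fun _ hy => ⟨ht, hy⟩

lemma differentiableAt_time_slice (hI : IsOpen I)
    (hF : ContDiffOn ℝ 1 (fun q : ℝ × E => F q.1 q.2) (I ×ˢ Ω)) (ht : t ∈ I) (hx : x ∈ Ω) :
    DifferentiableAt ℝ (fun τ => F τ x) t :=
  ((hF.comp (f := fun τ => (τ, x)) (s := I) (by fun_prop) fun _ hτ => ⟨hτ, hx⟩).differentiableOn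
    (by norm_num)).differentiableAt (hI.mem_nhds ht)

lemma differentiableAt_space_slice (hΩ : IsOpen Ω)
    (hF : ContDiffOn ℝ 1 (fun q : ℝ × E => F q.1 q.2) (I ×ˢ Ω)) (ht : t ∈ I) (hx : x ∈ Ω) :
    DifferentiableAt ℝ (F t) x :=
  ((contDiffOn_space_slice hF ht).differentiableOn (by norm_num)).differentiableAt
    (hΩ.mem_nhds hx)

variable {φ : ℝ → E → ℝ}

lemma fderiv_slice_apply (hI : IsOpen I) (hΩ : IsOpen Ω)
    (hφ : ContDiffOn ℝ 2 (fun q : ℝ × E => φ q.1 q.2) (I ×ˢ Ω)) (ht : t ∈ I) (hx : x ∈ Ω)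
    (v : E) :
    fderiv ℝ (φ t) x v = fderiv ℝ (fun q : ℝ × E => φ q.1 q.2) (t, x) (0, v) := by
  have hd := ((hφ.contDiffAt ((hI.prod hΩ).mem_nhds (mk_mem_prod ht hx))).differentiableAt
    (by norm_num)).hasFDerivAt
  have := hd.comp x (hasFDerivAt_prodMk_right t x)
  rw [show φ t = (fun q : ℝ × E => φ q.1 q.2) ∘ Prod.mk t from rfl, this.fderiv]
  rfl

lemma deriv_slice_eq (hI : IsOpen I) (hΩ : IsOpen Ω)
    (hφ : ContDiffOn ℝ 2 (fun q : ℝ × E => φ q.1 q.2) (I ×ˢ Ω)) (ht : t ∈ I) (hx : x ∈ Ω) :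
    deriv (fun τ => φ τ x) t = fderiv ℝ (fun q : ℝ × E => φ q.1 q.2) (t, x) (1, 0) := by
  have hd := ((hφ.contDiffAt ((hI.prod hΩ).mem_nhds (mk_mem_prod ht hx))).differentiableAt
    (by norm_num)).hasFDerivAt
  have := (hd.comp t (hasFDerivAt_prodMk_left t x)).hasDerivAt
  exact this.deriv

lemma contDiffOn_waveVec (hI : IsOpen I) (hΩ : IsOpen Ω)
    (hφ : ContDiffOn ℝ 2 (fun q : ℝ × E => φ q.1 q.2) (I ×ˢ Ω)) :
    ContDiffOn ℝ 1 (fun q : ℝ × E => waveVec φ q.1 q.2) (I ×ˢ Ω) := by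
  have hD : ContDiffOn ℝ 1 (fderiv ℝ (fun q : ℝ × E => φ q.1 q.2)) (I ×ˢ Ω) :=
    hφ.fderiv_of_isOpen (hI.prod hΩ) (by norm_num)
  rw [contDiffOn_piLp 2]
  intro i
  refine (hD.clm_apply (contDiffOn_const (c := ((0 : ℝ), EuclideanSpace.single i (1 : ℝ))))).congr
    fun q hq => ?_
  rw [waveVec, gradient_apply_eq_pd, pd, fderiv_slice_apply hI hΩ hφ hq.1 hq.2]

/-- Symmetry of the spatial Hessian of φ. -/
lemma waveVec_curl_free (hΩ : IsOpen Ω)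
    (hφ : ContDiffOn ℝ 2 (fun q : ℝ × E => φ q.1 q.2) (I ×ˢ Ω)) (ht : t ∈ I) (hx : x ∈ Ω)
    (i j : Fin 3) :
    pd i (fun y => waveVec φ t y j) x = pd j (fun y => waveVec φ t y i) x := by
  have h2 : ContDiffAt ℝ 2 (φ t) x :=
    (contDiffOn_space_slice hφ ht).contDiffAt (hΩ.mem_nhds hx)
  have hd : DifferentiableAt ℝ (fderiv ℝ (φ t)) x :=
    (h2.fderiv_right (m := 1) (by norm_num)).differentiableAt (by norm_num)
  have key : ∀ i j, pd i (fun y => waveVec φ t y j) x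
      = fderiv ℝ (fderiv ℝ (φ t)) x (EuclideanSpace.single i 1) (EuclideanSpace.single j 1) := by
    intro i j
    simp only [waveVec, gradient_apply_eq_pd]
    unfold pd
    rw [fderiv_clm_apply hd (differentiableAt_const _)]
    simp
  rw [key, key]
  exact h2.isSymmSndFDerivAt (by simp) _ _

lemma differentiableAt_deriv_phase (hI : IsOpen I) (hΩ : IsOpen Ω)
    (hφ : ContDiffOn ℝ 2 (fun q : ℝ × E => φ q.1 q.2) (I ×ˢ Ω)) (ht : t ∈ I) (hx : x ∈ Ω) :
    DifferentiableAt ℝ (fun y => deriv (fun τ => φ τ y) t) x := by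
  have hD : ContDiffOn ℝ 1 (fderiv ℝ (fun q : ℝ × E => φ q.1 q.2)) (I ×ˢ Ω) :=
    hφ.fderiv_of_isOpen (hI.prod hΩ) (by norm_num)
  have h : ContDiffOn ℝ 1 (fun q : ℝ × E => deriv (fun τ => φ τ q.2) q.1) (I ×ˢ Ω) :=
    (hD.clm_apply (contDiffOn_const (c := ((1 : ℝ), (0 : E))))).congr fun q hq =>
      deriv_slice_eq hI hΩ hφ hq.1 hq.2
  exact differentiableAt_space_slice (F := fun t y => deriv (fun τ => φ τ y) t) hΩ h ht hx

/-- Both sides are the second derivative of φ on ℝ × E in the directions (1, 0) and (0, eⱼ), which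
is symmetric since φ is jointly C². -/
lemma deriv_waveVec_apply (hI : IsOpen I) (hΩ : IsOpen Ω)
    (hφ : ContDiffOn ℝ 2 (fun q : ℝ × E => φ q.1 q.2) (I ×ˢ Ω)) (ht : t ∈ I) (hx : x ∈ Ω)
    (j : Fin 3) :
    deriv (fun τ => waveVec φ τ x j) t = pd j (fun y => deriv (fun τ => φ τ y) t) x := by
  have h2 := hφ.contDiffAt ((hI.prod hΩ).mem_nhds (show (t, x) ∈ I ×ˢ Ω from ⟨ht, hx⟩))
  have hd : DifferentiableAt ℝ (fderiv ℝ (fun q : ℝ × E => φ q.1 q.2)) (t, x) :=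
    (h2.fderiv_right (m := 1) (by norm_num)).differentiableAt (by norm_num)
  have hl : HasDerivAt (fun τ => fderiv ℝ (fun q : ℝ × E => φ q.1 q.2) (τ, x)
      (0, EuclideanSpace.single j (1 : ℝ))) (fderiv ℝ (fderiv ℝ (fun q : ℝ × E => φ q.1 q.2))
        (t, x) (1, 0) (0, EuclideanSpace.single j (1 : ℝ))) t := by
    have h := (hd.hasFDerivAt.comp t (hasFDerivAt_prodMk_left t x)).hasDerivAt
    simpa using h.clm_apply (hasDerivAt_const t ((0 : ℝ), EuclideanSpace.single j (1 : ℝ)))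
  have hr : HasFDerivAt (fun y => fderiv ℝ (fun q : ℝ × E => φ q.1 q.2) (t, y) ((1 : ℝ), (0 : E)))
      ((ContinuousLinearMap.apply ℝ ℝ ((1 : ℝ), (0 : E))).comp
        ((fderiv ℝ (fderiv ℝ (fun q : ℝ × E => φ q.1 q.2)) (t, x)).comp
          (ContinuousLinearMap.inr ℝ ℝ E))) x :=
    (ContinuousLinearMap.apply ℝ ℝ ((1 : ℝ), (0 : E))).hasFDerivAt.comp x
      (hd.hasFDerivAt.comp x (hasFDerivAt_prodMk_right t x))
  have hl' : (fun τ => waveVec φ τ x j) =ᶠ[𝓝 t] fun τ =>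
      fderiv ℝ (fun q : ℝ × E => φ q.1 q.2) (τ, x) (0, EuclideanSpace.single j (1 : ℝ)) := by
    filter_upwards [hI.mem_nhds ht] with τ hτ
    rw [waveVec, gradient_apply_eq_pd, pd, fderiv_slice_apply hI hΩ hφ hτ hx]
  have hr' : (fun y => deriv (fun τ => φ τ y) t) =ᶠ[𝓝 x] fun y =>
      fderiv ℝ (fun q : ℝ × E => φ q.1 q.2) (t, y) ((1 : ℝ), (0 : E)) := by
    filter_upwards [hΩ.mem_nhds hx] with y hy using deriv_slice_eq hI hΩ hφ ht hy
  rw [hl'.deriv_eq, hl.deriv, pd_congr hr', pd, hr.fderiv]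
  exact h2.isSymmSndFDerivAt (by simp) _ _

end SpaceTime

/-! ### Integration by parts and the weak Lie–Poisson form. -/

section WeakForm

variable {Ω : Set E}

lemma continuousOn_pd (hΩ : IsOpen Ω) {f : E → ℝ} (hf : ContDiffOn ℝ 1 f Ω) (i : Fin 3) :
    ContinuousOn (pd i f) Ω :=
  (hf.continuousOn_fderiv_of_isOpen hΩ (by norm_num)).clm_apply continuousOn_const

lemma contDiffOn_apply {F : E → E} {m : WithTop ℕ∞} (hF : ContDiffOn ℝ m F Ω) (i : Fin 3) :
    ContDiffOn ℝ m (fun y => F y i) Ω :=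
  (contDiffOn_piLp 2).1 hF i

lemma integrable_pd_test (hΩ : IsOpen Ω) {f θ : E → ℝ} (hf : ContDiffOn ℝ 1 f Ω)
    (hθ : Continuous θ) (hc : HasCompactSupport θ) (hs : tsupport θ ⊆ Ω) (i : Fin 3) :
    Integrable (fun x => pd i f x * θ x) :=
  integrable_of_eq_zero_off_compact hΩ hc hs ((continuousOn_pd hΩ hf i).mul hθ.continuousOn)
    fun x hx => by rw [image_eq_zero_of_notMem_tsupport hx, mul_zero]

lemma pd_eq_zero_of_notMem_tsupport {θ : E → ℝ} {x : E} (hx : x ∉ tsupport θ) (i : Fin 3) :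
    pd i θ x = 0 := by
  have h : θ =ᶠ[𝓝 x] fun _ => 0 := notMem_tsupport_iff_eventuallyEq.1 hx
  rw [pd_congr h, pd, fderiv_fun_const]
  rfl

/-- Integration by parts against a test function, in the form of a vanishing total derivative. -/
lemma integral_pd_mul_test (hΩ : IsOpen Ω) {f θ : E → ℝ} (hf : ContDiffOn ℝ 1 f Ω)
    (hθ : ContDiff ℝ 1 θ) (hc : HasCompactSupport θ) (hs : tsupport θ ⊆ Ω) (i : Fin 3) :
    IntegrableOn (fun x => f x * pd i θ x + pd i f x * θ x) Ω ∧
      ∫ x in Ω, (f x * pd i θ x + pd i f x * θ x) = 0 := by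
  have h1 := integrable_pd_test hΩ hf hθ.continuous hc hs i
  have h2 : Integrable (fun x => f x * pd i θ x) :=
    integrable_of_eq_zero_off_compact hΩ hc hs
      (hf.continuousOn.mul (continuousOn_pd hΩ hθ.contDiffOn i))
      fun x hx => by rw [pd_eq_zero_of_notMem_tsupport hx, mul_zero]
  have h3 : Integrable (fun x => f x * θ x) :=
    integrable_of_eq_zero_off_compact hΩ hc hs (hf.continuousOn.mul hθ.continuous.continuousOn)
      fun x hx => by rw [image_eq_zero_of_notMem_tsupport hx, mul_zero]
  have hparts := integral_mul_fderiv_eq_neg_fderiv_mul_of_integrable (μ := volume)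
    (v := EuclideanSpace.single i (1 : ℝ)) h1 h2 h3
    (fun x hx => (hf.contDiffAt (hΩ.mem_nhds (hs hx))).differentiableAt (by norm_num))
    (fun x _ => hθ.differentiable (by norm_num) x)
  refine ⟨(h2.add h1).integrableOn, ?_⟩
  rw [setIntegral_eq_integral_of_eq_zero_off hs fun x hx => by
    rw [pd_eq_zero_of_notMem_tsupport hx, image_eq_zero_of_notMem_tsupport hx, mul_zero, mul_zero,
      add_zero], integral_add h2 h1]
  exact add_eq_zero_iff_eq_neg.2 hparts

/-- The Lie–Poisson operator of `𝔛 ⋉ C^∞` is minus the coadjoint action in weak form. -/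
lemma integral_lpMom_lpDens_test (hΩ : IsOpen Ω) {p ξ : E → E} {n σ : E → ℝ}
    (hp : ContDiffOn ℝ 1 p Ω) (hn : ContDiffOn ℝ 1 n Ω) (hξ : ContDiffOn ℝ 1 ξ Ω)
    (hσ : ContDiffOn ℝ 1 σ Ω) {η : E → E} {τ : E → ℝ}
    (hη : ContDiff ℝ 1 η) (hηc : HasCompactSupport η) (hηs : tsupport η ⊆ Ω)
    (hτ : ContDiff ℝ 1 τ) (hτc : HasCompactSupport τ) (hτs : tsupport τ ⊆ Ω) :
    ∫ x in Ω, (∑ j, -lpMom p n ξ σ x j * η x j + -lpDens n ξ x * τ x)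
      = sdPairing Ω p n ξ σ η τ := by
  have hp' := contDiffOn_apply hp
  have hξ' := contDiffOn_apply hξ
  have hη' : ∀ j, ContDiff ℝ 1 (fun y => η y j) := (contDiff_piLp 2).1 hη
  have hsub : ∀ j, tsupport (fun y => η y j) ⊆ tsupport η := fun j =>
    closure_mono fun x hx h0 => hx (by simp [h0])
  have hηjc : ∀ j, HasCompactSupport (fun y => η y j) := fun j =>
    HasCompactSupport.of_support_subset_isCompact hηc ((subset_tsupport _).trans (hsub j))
  have hmom : ∀ j, Integrable (fun x => -lpMom p n ξ σ x j * η x j) := fun j => by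
    refine integrable_of_eq_zero_off_compact hΩ hηc hηs (ContinuousOn.mul (ContinuousOn.neg ?_)
      (hη' j).continuous.continuousOn)
      fun x hx => by rw [image_eq_zero_of_notMem_tsupport hx, PiLp.zero_apply, mul_zero]
    exact (continuousOn_finsetSum _ fun k _ =>
      ((hp' k).continuousOn.mul (continuousOn_pd hΩ (hξ' k) j)).add
        (continuousOn_pd hΩ ((hp' j).mul (hξ' k)) k)).add
      (hn.continuousOn.mul (continuousOn_pd hΩ hσ j))
  have hdens : Integrable (fun x => -lpDens n ξ x * τ x) :=
    integrable_of_eq_zero_off_compact hΩ hτc hτs (ContinuousOn.mul (ContinuousOn.neg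
      (continuousOn_finsetSum _ fun k _ => continuousOn_pd hΩ (hn.mul (hξ' k)) k))
      hτ.continuous.continuousOn)
      fun x hx => by rw [image_eq_zero_of_notMem_tsupport hx, mul_zero]
  have hflux := fun j k => integral_pd_mul_test hΩ ((hp' j).mul (hξ' k)) (hη' j) (hηjc j)
    ((hsub j).trans hηs) k
  have hflux' := fun k => integral_pd_mul_test hΩ (hn.mul (hξ' k)) hτ hτc hτs k
  have hlhs : IntegrableOn
      (fun x => ∑ j, -lpMom p n ξ σ x j * η x j + -lpDens n ξ x * τ x) Ω :=
    ((integrable_finsetSum _ fun j _ => hmom j).add hdens).integrableOn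
  have hM : IntegrableOn (fun x => ∑ j, ∑ k, (p x j * ξ x k * pd k (fun y => η y j) x
      + pd k (fun y => p y j * ξ y k) x * η x j)) Ω :=
    integrable_finsetSum _ fun j _ => integrable_finsetSum _ fun k _ => (hflux j k).1
  have hD : IntegrableOn (fun x => ∑ k, (n x * ξ x k * pd k τ x
      + pd k (fun y => n y * ξ y k) x * τ x)) Ω :=
    integrable_finsetSum _ fun k _ => (hflux' k).1
  have hM0 : ∫ x in Ω, ∑ j, ∑ k, (p x j * ξ x k * pd k (fun y => η y j) x
      + pd k (fun y => p y j * ξ y k) x * η x j) = 0 := by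
    rw [integral_finsetSum _ fun j _ => integrable_finsetSum _ fun k _ => (hflux j k).1]
    refine Finset.sum_eq_zero fun j _ => ?_
    rw [integral_finsetSum _ fun k _ => (hflux j k).1]
    exact Finset.sum_eq_zero fun k _ => (hflux j k).2
  have hD0 : ∫ x in Ω, ∑ k, (n x * ξ x k * pd k τ x
      + pd k (fun y => n y * ξ y k) x * τ x) = 0 := by
    rw [integral_finsetSum _ fun k _ => (hflux' k).1]
    exact Finset.sum_eq_zero fun k _ => (hflux' k).2
  -- The integrands agree up to ∂ₖ(pⱼξᵏηⱼ) and ∂ₖ(Nξᵏτ), which integrate to zero. The derivatives of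
  -- pⱼξᵏ and Nξᵏ stay unexpanded and cancel as they are.
  have hsplit : sdPairing Ω p n ξ σ η τ
      = ∫ x in Ω, ((∑ j, -lpMom p n ξ σ x j * η x j + -lpDens n ξ x * τ x)
        + (∑ j, ∑ k, (p x j * ξ x k * pd k (fun y => η y j) x
            + pd k (fun y => p y j * ξ y k) x * η x j)
          + ∑ k, (n x * ξ x k * pd k τ x + pd k (fun y => n y * ξ y k) x * τ x))) := by
    refine setIntegral_congr_fun hΩ.measurableSet fun x hx => ?_
    have hξd : DifferentiableAt ℝ ξ x :=
      (hξ.contDiffAt (hΩ.mem_nhds hx)).differentiableAt (by norm_num)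
    have hηd : DifferentiableAt ℝ η x := hη.differentiable (by norm_num) x
    simp only [VectorField.lieBracket_eq, inner_eq_sum, PiLp.sub_apply,
      fderiv_apply_component hξd, fderiv_apply_component hηd, fderiv_apply_eq_sum_pd, lpMom,
      lpDens, Fin.sum_univ_three]
    ring
  rw [hsplit]
  refine Eq.symm ((integral_add hlhs (hM.add hD)).trans ?_)
  simp only [Pi.add_apply]
  rw [integral_add hM hD, hM0, hD0, add_zero, add_zero]

end WeakForm

/-! ### Linearity of momentum transport, and the wave fields at p = Nκ. -/

lemma hasDerivAt_apply {F : ℝ → E} {F' : E} {t : ℝ} (hF : HasDerivAt F F' t) (i : Fin 3) :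
    HasDerivAt (fun τ => F τ i) (F' i) t :=
  (EuclideanSpace.proj i : E →L[ℝ] ℝ).hasFDerivAt.comp_hasDerivAt t hF

/-- Linearity of the transport operator in the momentum density. -/
lemma momTransport_sub {u m m' : ℝ → E → E} {t : ℝ} {x : E}
    (ht : DifferentiableAt ℝ (fun τ => m τ x) t) (ht' : DifferentiableAt ℝ (fun τ => m' τ x) t)
    (hx : DifferentiableAt ℝ (m t) x) (hx' : DifferentiableAt ℝ (m' t) x) (i : Fin 3) :
    momTransport u (fun t x => m t x - m' t x) t x i
      = momTransport u m t x i - momTransport u m' t x i := by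
  simp only [momTransport, PiLp.sub_apply]
  rw [deriv_fun_sub (hasDerivAt_apply ht.hasDerivAt i).differentiableAt
    (hasDerivAt_apply ht'.hasDerivAt i).differentiableAt]
  simp only [pd_sub _ (differentiableAt_apply hx i) (differentiableAt_apply hx' i),
    Fin.sum_univ_three]
  ring

section WaveFields

variable {Ω U : Set E} {ω n : E → ℝ} {κ u : E → E}

lemma lpVel_eqOn (hn0 : ∀ x ∈ Ω, n x ≠ 0) :
    EqOn (lpVel ω u (fun y => n y • κ y) n) (fun y => u y + groupVel ω (κ y)) Ω := fun x hx => by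
  simp only [lpVel, inv_smul_smul₀ (hn0 x hx)]

lemma lpFreq_eqOn (hn0 : ∀ x ∈ Ω, n x ≠ 0) :
    EqOn (lpFreq ω (fun y => n y • κ y) n) (fun y => ω (κ y) - ⟪κ y, groupVel ω (κ y)⟫) Ω :=
  fun x hx => by
    simp only [lpFreq, inv_smul_smul₀ (hn0 x hx), real_inner_smul_left,
      inv_mul_cancel_left₀ (hn0 x hx)]

lemma waveForce_eq (hΩ : IsOpen Ω) (hn0 : ∀ x ∈ Ω, n x ≠ 0) {x : E} (hx : x ∈ Ω) (i : Fin 3) :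
    waveForce ω (fun y => n y • κ y) n x i
      = κ x i * dvg (fun y => n y • groupVel ω (κ y)) x + n x * pd i (fun y => ω (κ y)) x := by
  have hev : ∀ᶠ y in 𝓝 x, (n y)⁻¹ • n y • κ y = κ y := by
    filter_upwards [hΩ.mem_nhds hx] with y hy using inv_smul_smul₀ (hn0 y hy) _
  rw [waveForce, dvg_congr (G := fun y => n y • groupVel ω (κ y)) (hev.mono fun y hy => by simp only [hy]),
    pd_congr (g := fun y => ω (κ y)) (hev.mono fun y hy => by simp only [hy])]
  simp only [hev.self_of_nhds]

end WaveFields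

/-! ### The closed system, its phase equation and its splitting. -/

section ClosedSystem

variable {I : Set ℝ} {Ω U : Set E} {ω : E → ℝ} {u : ℝ → E → E} {φ N : ℝ → E → ℝ}

lemma contDiffOn_pseudomom (hI : IsOpen I) (hΩ : IsOpen Ω)
    (hφ : ContDiffOn ℝ 2 (fun q : ℝ × E => φ q.1 q.2) (I ×ˢ Ω))
    (hN : ContDiffOn ℝ 1 (fun q : ℝ × E => N q.1 q.2) (I ×ˢ Ω)) :
    ContDiffOn ℝ 1 (fun q : ℝ × E => pseudomom N φ q.1 q.2) (I ×ˢ Ω) :=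
  hN.smul (contDiffOn_waveVec hI hΩ hφ)

lemma contDiffOn_waveVec_slice (hI : IsOpen I) (hΩ : IsOpen Ω)
    (hφ : ContDiffOn ℝ 2 (fun q : ℝ × E => φ q.1 q.2) (I ×ˢ Ω)) {t : ℝ} (ht : t ∈ I) :
    ContDiffOn ℝ 1 (waveVec φ t) Ω :=
  contDiffOn_space_slice (contDiffOn_waveVec hI hΩ hφ) ht

lemma contDiffOn_groupVel_comp (hU : IsOpen U) (hω : ContDiffOn ℝ 2 ω U) {κ : E → E}
    (hκ : ContDiffOn ℝ 1 κ Ω) (hκU : MapsTo κ Ω U) :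
    ContDiffOn ℝ 1 (fun y => groupVel ω (κ y)) Ω :=
  (contDiffOn_groupVel hU hω).comp hκ hκU

lemma contDiffOn_dispersion_comp (hω : ContDiffOn ℝ 2 ω U) {κ : E → E}
    (hκ : ContDiffOn ℝ 1 κ Ω) (hκU : MapsTo κ Ω U) : ContDiffOn ℝ 1 (fun y => ω (κ y)) Ω :=
  (hω.of_le (by norm_num)).comp hκ hκU

lemma contDiffOn_lpVel (hU : IsOpen U) (hω : ContDiffOn ℝ 2 ω U) {v κ : E → E} {n : E → ℝ}
    (hv : ContDiffOn ℝ 1 v Ω) (hn0 : ∀ x ∈ Ω, n x ≠ 0)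
    (hκ : ContDiffOn ℝ 1 κ Ω) (hκU : MapsTo κ Ω U) :
    ContDiffOn ℝ 1 (lpVel ω v (fun y => n y • κ y) n) Ω :=
  (hv.add (contDiffOn_groupVel_comp hU hω hκ hκU)).congr (lpVel_eqOn hn0)

lemma contDiffOn_lpFreq (hU : IsOpen U) (hω : ContDiffOn ℝ 2 ω U) {κ : E → E} {n : E → ℝ}
    (hn0 : ∀ x ∈ Ω, n x ≠ 0) (hκ : ContDiffOn ℝ 1 κ Ω) (hκU : MapsTo κ Ω U) :
    ContDiffOn ℝ 1 (lpFreq ω (fun y => n y • κ y) n) Ω :=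
  ((contDiffOn_dispersion_comp hω hκ hκU).sub
    (hκ.inner ℝ (contDiffOn_groupVel_comp hU hω hκ hκU))).congr (lpFreq_eqOn hn0)

/-- The defect of the wave momentum equation in terms of the defects of the wave action equation
and of the phase equation. -/
lemma deriv_pseudomom_add_lpMom (hI : IsOpen I) (hΩ : IsOpen Ω) (hU : IsOpen U)
    (hω : ContDiffOn ℝ 2 ω U)
    (hu : ContDiffOn ℝ 1 (fun q : ℝ × E => u q.1 q.2) (I ×ˢ Ω))
    (hφ : ContDiffOn ℝ 2 (fun q : ℝ × E => φ q.1 q.2) (I ×ˢ Ω))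
    (hN : ContDiffOn ℝ 1 (fun q : ℝ × E => N q.1 q.2) (I ×ˢ Ω))
    (hN0 : ∀ t ∈ I, ∀ x ∈ Ω, N t x ≠ 0) (hkU : ∀ t ∈ I, ∀ x ∈ Ω, waveVec φ t x ∈ U)
    {t : ℝ} (ht : t ∈ I) {x : E} (hx : x ∈ Ω) (j : Fin 3) :
    deriv (fun τ => pseudomom N φ τ x j) t
        + lpMom (pseudomom N φ t) (N t) (lpVel ω (u t) (pseudomom N φ t) (N t))
          (lpFreq ω (pseudomom N φ t) (N t)) x j
      = waveVec φ t x j * (deriv (fun τ => N τ x) t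
          + lpDens (N t) (lpVel ω (u t) (pseudomom N φ t) (N t)) x)
        + N t x * pd j (fun y => deriv (fun τ => φ τ y) t + ⟪u t y, waveVec φ t y⟫
          + ω (waveVec φ t y)) x := by
  have hκ := contDiffOn_waveVec_slice hI hΩ hφ ht
  have hdiff : ∀ {V : Type} [NormedAddCommGroup V] [NormedSpace ℝ V] {F : E → V},
      ContDiffOn ℝ 1 F Ω → DifferentiableAt ℝ F x := fun hF =>
    (hF.contDiffAt (hΩ.mem_nhds hx)).differentiableAt (by norm_num)
  have hWd := hdiff (contDiffOn_dispersion_comp hω hκ (hkU t ht))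
  have hκd := hdiff hκ
  have hud := differentiableAt_space_slice hΩ hu ht hx
  have hvel := (lpVel_eqOn (ω := ω) (κ := waveVec φ t) (u := u t) (hN0 t ht)).eventuallyEq_of_mem
    (hΩ.mem_nhds hx)
  have hfreq := (lpFreq_eqOn (ω := ω) (κ := waveVec φ t) (hN0 t ht)).eventuallyEq_of_mem
    (hΩ.mem_nhds hx)
  have hmom := (lpMom_congr hvel hfreq j).trans
    (lpMom_eq_lpDens_add (differentiableAt_space_slice hΩ hN ht hx) hWd hκd hud
      (hdiff (contDiffOn_groupVel_comp hU hω hκ (hkU t ht)))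
      (fun i j => waveVec_curl_free hΩ hφ ht hx i j) j)
  have hdens : lpDens (N t) (lpVel ω (u t) (pseudomom N φ t) (N t)) x
      = lpDens (N t) (fun y => u t y + groupVel ω (waveVec φ t y)) x :=
    dvg_congr (hvel.mono fun y hy => congrArg (N t y • ·) hy)
  have htime : deriv (fun τ => pseudomom N φ τ x j) t
      = N t x * pd j (fun y => deriv (fun τ => φ τ y) t) x
        + deriv (fun τ => N τ x) t * waveVec φ t x j := by
    have hk := hasDerivAt_apply (differentiableAt_time_slice hI
      (contDiffOn_waveVec hI hΩ hφ) ht hx).hasDerivAt j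
    rw [← deriv_waveVec_apply hI hΩ hφ ht hx j]
    simp only [pseudomom, PiLp.smul_apply, smul_eq_mul]
    rw [deriv_fun_mul (differentiableAt_time_slice hI hN ht hx) hk.differentiableAt]
    ring
  have hphase : pd j (fun y => deriv (fun τ => φ τ y) t + ⟪u t y, waveVec φ t y⟫
          + ω (waveVec φ t y)) x
      = pd j (fun y => deriv (fun τ => φ τ y) t) x
        + pd j (fun y => ⟪u t y, waveVec φ t y⟫ + ω (waveVec φ t y)) x := by
    have hud' : DifferentiableAt ℝ (fun y => ⟪u t y, waveVec φ t y⟫ + ω (waveVec φ t y)) x :=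
      (hud.inner ℝ hκd).add hWd
    rw [← pd_add j (differentiableAt_deriv_phase hI hΩ hφ ht hx) hud']
    simp only [add_assoc]
  rw [htime, hdens, hphase]
  refine (congrArg (_ + ·) hmom).trans ?_
  ring

/-- An identity independent of any evolution equation: it translates the Lie–Poisson wave momentum
equation into M(p) = -F_W. -/
lemma momTransport_pseudomom_add_waveForce (hI : IsOpen I) (hΩ : IsOpen Ω) (hU : IsOpen U)
    (hω : ContDiffOn ℝ 2 ω U)
    (hu : ContDiffOn ℝ 1 (fun q : ℝ × E => u q.1 q.2) (I ×ˢ Ω))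
    (hφ : ContDiffOn ℝ 2 (fun q : ℝ × E => φ q.1 q.2) (I ×ˢ Ω))
    (hN : ContDiffOn ℝ 1 (fun q : ℝ × E => N q.1 q.2) (I ×ˢ Ω))
    (hN0 : ∀ t ∈ I, ∀ x ∈ Ω, N t x ≠ 0) (hkU : ∀ t ∈ I, ∀ x ∈ Ω, waveVec φ t x ∈ U)
    {t : ℝ} (ht : t ∈ I) {x : E} (hx : x ∈ Ω) (j : Fin 3) :
    momTransport u (pseudomom N φ) t x j + waveForce ω (pseudomom N φ t) (N t) x j
      = deriv (fun τ => pseudomom N φ τ x j) t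
        + lpMom (pseudomom N φ t) (N t) (lpVel ω (u t) (pseudomom N φ t) (N t))
          (lpFreq ω (pseudomom N φ t) (N t)) x j := by
  have hκ := contDiffOn_waveVec_slice hI hΩ hφ ht
  have hdiff : ∀ {V : Type} [NormedAddCommGroup V] [NormedSpace ℝ V] {F : E → V},
      ContDiffOn ℝ 1 F Ω → DifferentiableAt ℝ F x := fun hF =>
    (hF.contDiffAt (hΩ.mem_nhds hx)).differentiableAt (by norm_num)
  have hvel := (lpVel_eqOn (ω := ω) (κ := waveVec φ t) (u := u t) (hN0 t ht)).eventuallyEq_of_mem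
    (hΩ.mem_nhds hx)
  have hfreq := (lpFreq_eqOn (ω := ω) (κ := waveVec φ t) (hN0 t ht)).eventuallyEq_of_mem
    (hΩ.mem_nhds hx)
  have hmom := (lpMom_congr hvel hfreq j).trans
    (lpMom_eq_transport_add_force (differentiableAt_space_slice hΩ hN ht hx)
      (hdiff (contDiffOn_dispersion_comp hω hκ (hkU t ht))) (hdiff hκ)
      (differentiableAt_space_slice hΩ hu ht hx)
      (hdiff (contDiffOn_groupVel_comp hU hω hκ (hkU t ht)))
      (fun i j => waveVec_curl_free hΩ hφ ht hx i j) j)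
  have hforce := waveForce_eq (ω := ω) (κ := waveVec φ t) hΩ (hN0 t ht) hx j
  refine (congrArg (_ + ·) hforce).trans (Eq.symm ((congrArg (_ + ·) hmom).trans ?_))
  simp only [momTransport, pseudomom]
  ring

/-- Solutions of the closed system satisfy the phase equation up to a function of time. -/
lemma IsClosedGLM.exists_phase_eq {g s : ℝ} {R : E → E} {D b pr : ℝ → E → ℝ}
    (h : IsClosedGLM I Ω g R ω s u D b pr (pseudomom N φ) N)
    (hI : IsOpen I) (hΩ : IsOpen Ω) (hΩc : IsPreconnected Ω) (hU : IsOpen U)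
    (hω : ContDiffOn ℝ 2 ω U)
    (hu : ContDiffOn ℝ 1 (fun q : ℝ × E => u q.1 q.2) (I ×ˢ Ω))
    (hφ : ContDiffOn ℝ 2 (fun q : ℝ × E => φ q.1 q.2) (I ×ˢ Ω))
    (hN : ContDiffOn ℝ 1 (fun q : ℝ × E => N q.1 q.2) (I ×ˢ Ω))
    (hN0 : ∀ t ∈ I, ∀ x ∈ Ω, N t x ≠ 0) (hkU : ∀ t ∈ I, ∀ x ∈ Ω, waveVec φ t x ∈ U) :
    ∃ c : ℝ → ℝ, ∀ t ∈ I, ∀ x ∈ Ω,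
      deriv (fun τ => φ τ x) t + ⟪u t x, waveVec φ t x⟫ + ω (waveVec φ t x) = c t := by
  have hconst : ∀ t, ∃ c : ℝ, t ∈ I → ∀ x ∈ Ω,
      deriv (fun τ => φ τ x) t + ⟪u t x, waveVec φ t x⟫ + ω (waveVec φ t x) = c := by
    intro t
    by_cases ht : t ∈ I
    swap
    -- Arbitrary value: nothing is claimed at times outside I.
    · exact ⟨0, fun h => absurd h ht⟩
    have hκ := contDiffOn_waveVec_slice hI hΩ hφ ht
    have hd : DifferentiableOn ℝ (fun y => deriv (fun τ => φ τ y) t + ⟪u t y, waveVec φ t y⟫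
        + ω (waveVec φ t y)) Ω :=
      DifferentiableOn.add (DifferentiableOn.add
        (fun x hx => (differentiableAt_deriv_phase hI hΩ hφ ht hx).differentiableWithinAt)
        (((contDiffOn_space_slice hu ht).inner ℝ hκ).differentiableOn (by norm_num)))
        ((contDiffOn_dispersion_comp hω hκ (hkU t ht)).differentiableOn (by norm_num))
    -- Both wave equations kill their defects, leaving N times the gradient of the phase defect
    -- equal to zero, with N ≠ 0.
    obtain ⟨c, hc⟩ := hΩ.exists_is_const_of_fderiv_eq_zero hΩc hd fun x hx =>
      fderiv_eq_zero_of_pd fun j => by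
        have key := deriv_pseudomom_add_lpMom hI hΩ hU hω hu hφ hN hN0 hkU ht hx j
        rw [h.wave_momentum t ht x hx j, h.wave_action t ht x hx] at key
        simp only [neg_add_cancel, mul_zero, zero_add] at key
        exact (mul_eq_zero.1 key.symm).resolve_left (hN0 t ht x hx)
    exact ⟨c, fun _ => hc⟩
  choose c hc using hconst
  exact ⟨c, fun t ht => hc t ht⟩

lemma lpDens_lpVel_eq_dvg_add (hU : IsOpen U) (hω : ContDiffOn ℝ 2 ω U)
    (hI : IsOpen I) (hΩ : IsOpen Ω)
    (hu : ContDiffOn ℝ 1 (fun q : ℝ × E => u q.1 q.2) (I ×ˢ Ω))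
    (hφ : ContDiffOn ℝ 2 (fun q : ℝ × E => φ q.1 q.2) (I ×ˢ Ω))
    (hN : ContDiffOn ℝ 1 (fun q : ℝ × E => N q.1 q.2) (I ×ˢ Ω))
    (hN0 : ∀ t ∈ I, ∀ x ∈ Ω, N t x ≠ 0) (hkU : ∀ t ∈ I, ∀ x ∈ Ω, waveVec φ t x ∈ U)
    {t : ℝ} (ht : t ∈ I) {x : E} (hx : x ∈ Ω) :
    lpDens (N t) (lpVel ω (u t) (pseudomom N φ t) (N t)) x
      = dvg (fun y => N t y • u t y) x
        + dvg (fun y => N t y • groupVel ω (waveVec φ t y)) x := by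
  have hκ := contDiffOn_waveVec_slice hI hΩ hφ ht
  have hvel := (lpVel_eqOn (ω := ω) (κ := waveVec φ t) (u := u t) (hN0 t ht)).eventuallyEq_of_mem
    (hΩ.mem_nhds hx)
  have hNd := differentiableAt_space_slice hΩ hN ht hx
  have hNu : DifferentiableAt ℝ (fun y => N t y • u t y) x :=
    hNd.smul (differentiableAt_space_slice hΩ hu ht hx)
  have hNv : DifferentiableAt ℝ (fun y => N t y • groupVel ω (waveVec φ t y)) x :=
    hNd.smul (((contDiffOn_groupVel_comp hU hω hκ (hkU t ht)).contDiffAt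
      (hΩ.mem_nhds hx)).differentiableAt (by norm_num))
  rw [← dvg_add hNu hNv]
  exact dvg_congr (hvel.mono fun y hy =>
    (congrArg (N t y • ·) hy).trans (smul_add _ _ _))

/-- The wave–current equations are the closed system together with the phase equation. -/
lemma isWaveCurrent_iff_isClosedGLM {g s : ℝ} {R : E → E} {D b pr : ℝ → E → ℝ}
    (hI : IsOpen I) (hΩ : IsOpen Ω) (hU : IsOpen U) (hω : ContDiffOn ℝ 2 ω U)
    (hu : ContDiffOn ℝ 1 (fun q : ℝ × E => u q.1 q.2) (I ×ˢ Ω))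
    (hφ : ContDiffOn ℝ 2 (fun q : ℝ × E => φ q.1 q.2) (I ×ˢ Ω))
    (hN : ContDiffOn ℝ 1 (fun q : ℝ × E => N q.1 q.2) (I ×ˢ Ω))
    (hN0 : ∀ t ∈ I, ∀ x ∈ Ω, N t x ≠ 0) (hkU : ∀ t ∈ I, ∀ x ∈ Ω, waveVec φ t x ∈ U)
    (hH : ∀ t ∈ I, IntegrableOn (fun x => N t x * ω (waveVec φ t x)) Ω) :
    IsWaveCurrent I Ω g R (waveHam Ω ω) s u D b φ N pr ↔
      IsClosedGLM I Ω g R ω s u D b pr (pseudomom N φ) N ∧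
      ∀ t ∈ I, ∀ x ∈ Ω, deriv (fun τ => φ τ x) t + ⟪u t x, waveVec φ t x⟫
        = -ω (waveVec φ t x) := by
  have hκ : ∀ t ∈ I, ContDiffOn ℝ 1 (waveVec φ t) Ω := fun t ht =>
    contDiffOn_waveVec_slice hI hΩ hφ ht
  have hA : ∀ t ∈ I, ContDiffOn ℝ 1 (fun x => -ω (waveVec φ t x)) Ω := fun t ht =>
    (contDiffOn_dispersion_comp hω (hκ t ht) (hkU t ht)).neg
  have hB : ∀ t ∈ I, ContDiffOn ℝ 1 (fun x => -(N t x • groupVel ω (waveVec φ t x))) Ω :=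
    fun t ht => ((contDiffOn_space_slice hN ht).smul
      (contDiffOn_groupVel_comp hU hω (hκ t ht) (hkU t ht))).neg
  have hvA : ∀ t ∈ I, HasVarDeriv Ω (fun N' => waveHam Ω ω N' (waveVec φ t)) (N t)
      (fun x => -ω (waveVec φ t x)) := fun t ht =>
    hasVarDeriv_waveHam_density hΩ hω (contDiffOn_space_slice hN ht).continuousOn
      (hκ t ht).continuousOn (hkU t ht) (hH t ht)
  have hvB : ∀ t ∈ I, HasVarDeriv Ω (fun k' => waveHam Ω ω (N t) k') (waveVec φ t)
      (fun x => -(N t x • groupVel ω (waveVec φ t x))) := fun t ht =>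
    hasVarDeriv_waveHam_waveVec hΩ hU hω (contDiffOn_space_slice hN ht).continuousOn
      (hκ t ht).continuousOn (hkU t ht) (hH t ht)
  have hforce : ∀ t ∈ I, ∀ x ∈ Ω, ∀ i,
      waveVec φ t x i * dvg (fun y => -(N t y • groupVel ω (waveVec φ t y))) x
        + N t x * pd i (fun y => -ω (waveVec φ t y)) x
      = -waveForce ω (pseudomom N φ t) (N t) x i := fun t ht x hx i => by
    rw [dvg_neg, pd_neg]
    refine Eq.trans ?_
      (congrArg Neg.neg (waveForce_eq (κ := waveVec φ t) hΩ (hN0 t ht) hx i)).symm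
    ring
  have hdens := fun t (ht : t ∈ I) x (hx : x ∈ Ω) =>
    lpDens_lpVel_eq_dvg_add hU hω hI hΩ hu hφ hN hN0 hkU ht hx
  constructor
  · rintro ⟨A, B, hAB, hmot, htr, hph, hact⟩
    -- A and B are only known to be C¹ variational derivatives; uniqueness identifies them on Ω, and
    -- openness of Ω carries this over to their derivatives.
    have hAeq : ∀ t ∈ I, EqOn (A t) (fun x => -ω (waveVec φ t x)) Ω := fun t ht =>
      (hAB t ht).2.2.1.eqOn hΩ (hvA t ht) (hAB t ht).1.continuousOn (hA t ht).continuousOn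
    have hBeq : ∀ t ∈ I, EqOn (B t) (fun x => -(N t x • groupVel ω (waveVec φ t x))) Ω :=
      fun t ht => (hAB t ht).2.2.2.eqOn hΩ (hvB t ht) (hAB t ht).2.1.continuousOn
        (hB t ht).continuousOn
    have hdvg : ∀ t ∈ I, ∀ x ∈ Ω,
        dvg (B t) x = dvg (fun y => -(N t y • groupVel ω (waveVec φ t y))) x :=
      fun t ht x hx => dvg_congr ((hBeq t ht).eventuallyEq_of_mem (hΩ.mem_nhds hx))
    have hphase : ∀ t ∈ I, ∀ x ∈ Ω, deriv (fun τ => φ τ x) t + ⟪u t x, waveVec φ t x⟫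
        = -ω (waveVec φ t x) := fun t ht x hx => by
      have := hph t ht x hx
      rw [hAeq t ht hx] at this
      linarith
    have haction : ∀ t ∈ I, ∀ x ∈ Ω, deriv (fun τ => N τ x) t
        = -lpDens (N t) (lpVel ω (u t) (pseudomom N φ t) (N t)) x := fun t ht x hx => by
      have := hact t ht x hx
      rw [hdvg t ht x hx, dvg_neg] at this
      rw [hdens t ht x hx]
      linarith
    refine ⟨⟨fun t ht x hx i => ?_, htr, fun t ht x hx j => ?_, haction⟩, hphase⟩
    · rw [hmot t ht x hx i, hdvg t ht x hx,
        pd_congr ((hAeq t ht).eventuallyEq_of_mem (hΩ.mem_nhds hx)), hforce t ht x hx i]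
      ring
    -- The phase equation holds on all of Ω, so the gradient of its defect vanishes; with wave
    -- action this gives the wave momentum equation.
    · have key := deriv_pseudomom_add_lpMom hI hΩ hU hω hu hφ hN hN0 hkU ht hx j
      have hzero : pd j (fun y => deriv (fun τ => φ τ y) t + ⟪u t y, waveVec φ t y⟫
          + ω (waveVec φ t y)) x = 0 := by
        have hev : (fun y => deriv (fun τ => φ τ y) t + ⟪u t y, waveVec φ t y⟫
            + ω (waveVec φ t y)) =ᶠ[𝓝 x] fun _ => 0 := by
          filter_upwards [hΩ.mem_nhds hx] with y hy
          rw [hphase t ht y hy, neg_add_cancel]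
        rw [pd_congr hev, pd, fderiv_fun_const]
        rfl
      rw [hzero, haction t ht x hx] at key
      linarith
  · rintro ⟨h, hphase⟩
    refine ⟨fun t x => -ω (waveVec φ t x), fun t x => -(N t x • groupVel ω (waveVec φ t x)),
      fun t ht => ⟨hA t ht, hB t ht, hvA t ht, hvB t ht⟩, fun t ht x hx i => ?_, h.transport,
      fun t ht x hx => ?_, fun t ht x hx => ?_⟩
    · rw [h.motion t ht x hx i, hforce t ht x hx i]
      ring
    · rw [hphase t ht x hx, sub_self]
    · rw [h.wave_action t ht x hx, hdens t ht x hx, dvg_neg]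
      ring

/-- The wave part of the closed system is Lie–Poisson in weak form. -/
lemma IsClosedGLM.integral_deriv_test {g s : ℝ} {R : E → E} {D b pr : ℝ → E → ℝ}
    (h : IsClosedGLM I Ω g R ω s u D b pr (pseudomom N φ) N)
    (hI : IsOpen I) (hΩ : IsOpen Ω) (hU : IsOpen U) (hω : ContDiffOn ℝ 2 ω U)
    (hu : ContDiffOn ℝ 1 (fun q : ℝ × E => u q.1 q.2) (I ×ˢ Ω))
    (hφ : ContDiffOn ℝ 2 (fun q : ℝ × E => φ q.1 q.2) (I ×ˢ Ω))
    (hN : ContDiffOn ℝ 1 (fun q : ℝ × E => N q.1 q.2) (I ×ˢ Ω))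
    (hN0 : ∀ t ∈ I, ∀ x ∈ Ω, N t x ≠ 0) (hkU : ∀ t ∈ I, ∀ x ∈ Ω, waveVec φ t x ∈ U)
    {t : ℝ} (ht : t ∈ I) {η : E → E} {τ : E → ℝ}
    (hη : ContDiff ℝ 1 η) (hηc : HasCompactSupport η) (hηs : tsupport η ⊆ Ω)
    (hτ : ContDiff ℝ 1 τ) (hτc : HasCompactSupport τ) (hτs : tsupport τ ⊆ Ω) :
    ∫ x in Ω, (⟪deriv (fun r => pseudomom N φ r x) t, η x⟫ + deriv (fun r => N r x) t * τ x)
      = sdPairing Ω (pseudomom N φ t) (N t) (lpVel ω (u t) (pseudomom N φ t) (N t))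
          (lpFreq ω (pseudomom N φ t) (N t)) η τ := by
  have hp := contDiffOn_pseudomom hI hΩ hφ hN
  have hκ := contDiffOn_waveVec_slice hI hΩ hφ ht
  refine Eq.trans ?_ (integral_lpMom_lpDens_test hΩ (contDiffOn_space_slice hp ht)
    (contDiffOn_space_slice hN ht)
    (contDiffOn_lpVel hU hω (contDiffOn_space_slice hu ht) (hN0 t ht) hκ (hkU t ht))
    (contDiffOn_lpFreq hU hω (hN0 t ht) hκ (hkU t ht)) hη hηc hηs hτ hτc hτs)
  refine setIntegral_congr_fun hΩ.measurableSet fun x hx => ?_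
  have hd := (differentiableAt_time_slice hI hp ht hx).hasDerivAt
  simp only [inner_eq_sum, h.wave_action t ht x hx]
  congr 1
  refine Finset.sum_congr rfl fun j _ => ?_
  rw [← (hasDerivAt_apply hd j).deriv, h.wave_momentum t ht x hx j]
  rfl

/-- The closed system splits into momentum equations for the waves and for the current. -/
lemma IsClosedGLM.momTransport_split {g s : ℝ} {R : E → E} {D b pr : ℝ → E → ℝ}
    (h : IsClosedGLM I Ω g R ω s u D b pr (pseudomom N φ) N)
    (hI : IsOpen I) (hΩ : IsOpen Ω) (hU : IsOpen U) (hω : ContDiffOn ℝ 2 ω U)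
    (hR : ContDiffOn ℝ 1 R Ω)
    (hu : ContDiffOn ℝ 1 (fun q : ℝ × E => u q.1 q.2) (I ×ˢ Ω))
    (hD : ContDiffOn ℝ 1 (fun q : ℝ × E => D q.1 q.2) (I ×ˢ Ω))
    (hφ : ContDiffOn ℝ 2 (fun q : ℝ × E => φ q.1 q.2) (I ×ˢ Ω))
    (hN : ContDiffOn ℝ 1 (fun q : ℝ × E => N q.1 q.2) (I ×ˢ Ω))
    (hN0 : ∀ t ∈ I, ∀ x ∈ Ω, N t x ≠ 0) (hkU : ∀ t ∈ I, ∀ x ∈ Ω, waveVec φ t x ∈ U)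
    {t : ℝ} (ht : t ∈ I) {x : E} (hx : x ∈ Ω) (i : Fin 3) :
    momTransport u (pseudomom N φ) t x i = -waveForce ω (pseudomom N φ t) (N t) x i ∧
      momTransport u (currentMom R u D) t x i
        = fluidForce g R u D b pr t x i
          - (1 + s) * waveForce ω (pseudomom N φ t) (N t) x i := by
  have hp := contDiffOn_pseudomom hI hΩ hφ hN
  have hm : ContDiffOn ℝ 1 (fun q : ℝ × E => currentMom R u D q.1 q.2) (I ×ˢ Ω) :=
    hD.smul (hu.add (hR.comp contDiffOn_snd fun _ hq => hq.2))
  have hwave : momTransport u (pseudomom N φ) t x i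
      = -waveForce ω (pseudomom N φ t) (N t) x i := by
    have key := momTransport_pseudomom_add_waveForce hI hΩ hU hω hu hφ hN hN0 hkU ht hx i
    rw [h.wave_momentum t ht x hx i] at key
    linarith
  refine ⟨hwave, ?_⟩
  -- By linearity M(D(u + R)) = M(m) + M(p): the force -s F_W in the first term and -F_W in the
  -- second combine to -(1 + s) F_W.
  have hsub := momTransport_sub (u := u) (differentiableAt_time_slice hI hm ht hx)
    (differentiableAt_time_slice hI hp ht hx) (differentiableAt_space_slice hΩ hm ht hx)
    (differentiableAt_space_slice hΩ hp ht hx) i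
  rw [h.motion t ht x hx i, hwave] at hsub
  linarith

end ClosedSystem

end WCI

/-! ### The full proposition. -/

theorem mainTheorem5
    (I : Set ℝ) (hI : IsOpen I) (Ω : Set WCI.E) (hΩ : IsOpen Ω)
    (U : Set WCI.E) (hU : IsOpen U) (ω : WCI.E → ℝ) (hω : ContDiffOn ℝ 2 ω U)
    (g : ℝ) (R : WCI.E → WCI.E) (hR : ContDiffOn ℝ 1 R Ω)
    (u : ℝ → WCI.E → WCI.E) (D b φ N pr : ℝ → WCI.E → ℝ)
    (hu : ContDiffOn ℝ 1 (fun q : ℝ × WCI.E => u q.1 q.2) (I ×ˢ Ω))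
    (hD : ContDiffOn ℝ 1 (fun q : ℝ × WCI.E => D q.1 q.2) (I ×ˢ Ω))
    (hb : ContDiffOn ℝ 1 (fun q : ℝ × WCI.E => b q.1 q.2) (I ×ˢ Ω))
    (hφ : ContDiffOn ℝ 2 (fun q : ℝ × WCI.E => φ q.1 q.2) (I ×ˢ Ω))
    (hN : ContDiffOn ℝ 1 (fun q : ℝ × WCI.E => N q.1 q.2) (I ×ˢ Ω))
    (hpr : ContDiffOn ℝ 1 (fun q : ℝ × WCI.E => pr q.1 q.2) (I ×ˢ Ω))
    (hN0 : ∀ t ∈ I, ∀ x ∈ Ω, N t x ≠ 0)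
    (hkU : ∀ t ∈ I, ∀ x ∈ Ω, WCI.waveVec φ t x ∈ U)
    (hH : ∀ t ∈ I, IntegrableOn (fun x => N t x * ω (WCI.waveVec φ t x)) Ω)
    (hpu : ∀ t ∈ I, IntegrableOn (fun x => ⟪WCI.pseudomom N φ t x, u t x⟫) Ω) :
    -- variational derivatives of the wave Hamiltonian in the variables `(N, k)`
    (∀ t ∈ I,
      WCI.HasVarDeriv Ω (fun N' => WCI.waveHam Ω ω N' (WCI.waveVec φ t)) (N t)
        (fun x => -ω (WCI.waveVec φ t x)) ∧
      WCI.HasVarDeriv Ω (fun k' => WCI.waveHam Ω ω (N t) k') (WCI.waveVec φ t)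
        (fun x => -(N t x • WCI.groupVel ω (WCI.waveVec φ t x)))) ∧
    -- variational derivatives in the Lie–Poisson variables `(p, N)`
    (∀ t ∈ I,
      WCI.HasVarDeriv Ω (fun p' => WCI.waveHamLP Ω ω p' (N t)) (WCI.pseudomom N φ t)
        (fun x => -WCI.groupVel ω ((N t x)⁻¹ • WCI.pseudomom N φ t x)) ∧
      WCI.HasVarDeriv Ω (fun N' => WCI.waveHamLP Ω ω (WCI.pseudomom N φ t) N') (N t)
        (fun x => -WCI.lpFreq ω (WCI.pseudomom N φ t) (N t) x) ∧
      WCI.HasVarDeriv Ω (fun p' => WCI.boostedWaveHam Ω ω (u t) p' (N t))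
        (WCI.pseudomom N φ t) (WCI.lpVel ω (u t) (WCI.pseudomom N φ t) (N t)) ∧
      WCI.HasVarDeriv Ω (fun N' => WCI.boostedWaveHam Ω ω (u t) (WCI.pseudomom N φ t) N')
        (N t) (WCI.lpFreq ω (WCI.pseudomom N φ t) (N t))) ∧
    (∀ s : ℝ,
      -- the wave–current equations are the closed GLM system for `p = N∇φ` and the phase equation
      (WCI.IsWaveCurrent I Ω g R (WCI.waveHam Ω ω) s u D b φ N pr ↔
        WCI.IsClosedGLM I Ω g R ω s u D b pr (WCI.pseudomom N φ) N ∧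
        ∀ t ∈ I, ∀ x ∈ Ω, deriv (fun τ => φ τ x) t + ⟪u t x, WCI.waveVec φ t x⟫
          = -ω (WCI.waveVec φ t x)) ∧
      -- the closed GLM system determines the phase equation up to a function of time
      (IsPreconnected Ω → WCI.IsClosedGLM I Ω g R ω s u D b pr (WCI.pseudomom N φ) N →
        ∃ c : ℝ → ℝ, ∀ t ∈ I, ∀ x ∈ Ω,
          deriv (fun τ => φ τ x) t + ⟪u t x, WCI.waveVec φ t x⟫ + ω (WCI.waveVec φ t x)
            = c t) ∧
      -- the wave part is Lie–Poisson on the dual of the semidirect product `𝔛 ⋉ C^∞`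
      (WCI.IsClosedGLM I Ω g R ω s u D b pr (WCI.pseudomom N φ) N →
        ∀ t ∈ I, ∀ (η : WCI.E → WCI.E) (τ : WCI.E → ℝ),
          ContDiff ℝ (⊤ : ℕ∞) η → HasCompactSupport η → tsupport η ⊆ Ω →
          ContDiff ℝ (⊤ : ℕ∞) τ → HasCompactSupport τ → tsupport τ ⊆ Ω →
          ∫ x in Ω, (⟪deriv (fun r => WCI.pseudomom N φ r x) t, η x⟫
              + deriv (fun r => N r x) t * τ x)
            = WCI.sdPairing Ω (WCI.pseudomom N φ t) (N t)
                (WCI.lpVel ω (u t) (WCI.pseudomom N φ t) (N t))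
                (WCI.lpFreq ω (WCI.pseudomom N φ t) (N t)) η τ) ∧
      -- the separate momentum equations of the waves and of the current
      (WCI.IsClosedGLM I Ω g R ω s u D b pr (WCI.pseudomom N φ) N →
        ∀ t ∈ I, ∀ x ∈ Ω, ∀ i,
          WCI.momTransport u (WCI.pseudomom N φ) t x i
            = -WCI.waveForce ω (WCI.pseudomom N φ t) (N t) x i ∧
          WCI.momTransport u (WCI.currentMom R u D) t x i
            = WCI.fluidForce g R u D b pr t x i
              - (1 + s) * WCI.waveForce ω (WCI.pseudomom N φ t) (N t) x i)) := by
  have hn : ∀ t ∈ I, ContinuousOn (N t) Ω := fun t ht =>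
    (WCI.contDiffOn_space_slice hN ht).continuousOn
  have hk : ∀ t ∈ I, ContinuousOn (WCI.waveVec φ t) Ω := fun t ht =>
    (WCI.contDiffOn_waveVec_slice hI hΩ hφ ht).continuousOn
  refine ⟨fun t ht => ⟨WCI.hasVarDeriv_waveHam_density hΩ hω (hn t ht) (hk t ht) (hkU t ht)
    (hH t ht), WCI.hasVarDeriv_waveHam_waveVec hΩ hU hω (hn t ht) (hk t ht) (hkU t ht)
    (hH t ht)⟩, fun t ht => ?_, fun s => ⟨?_, ?_, ?_, ?_⟩⟩
  · have hp : ContinuousOn (WCI.pseudomom N φ t) Ω := (hn t ht).smul (hk t ht)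
    have hut : ContinuousOn (u t) Ω := (WCI.contDiffOn_space_slice hu ht).continuousOn
    have hpk : EqOn (fun x => (N t x)⁻¹ • WCI.pseudomom N φ t x) (WCI.waveVec φ t) Ω :=
      fun x hx => inv_smul_smul₀ (hN0 t ht x hx) _
    have hpU : MapsTo (fun x => (N t x)⁻¹ • WCI.pseudomom N φ t x) Ω U := fun x hx => by
      simpa only [hpk hx] using hkU t ht x hx
    have hHp : IntegrableOn (fun x => N t x * ω ((N t x)⁻¹ • WCI.pseudomom N φ t x)) Ω :=
      (hH t ht).congr_fun (fun x hx => by simp only [hpk hx]) hΩ.measurableSet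
    have hv : ContinuousOn (fun x => -WCI.groupVel ω ((N t x)⁻¹ • WCI.pseudomom N φ t x)) Ω :=
      ((WCI.contDiffOn_groupVel hU hω).continuousOn.comp ((hk t ht).congr hpk) hpU).neg
    have hdp := WCI.hasVarDeriv_waveHamLP_momentum hΩ hU hω (hn t ht) (hN0 t ht) hp hpU hHp
    have hdN := WCI.hasVarDeriv_waveHamLP_density hΩ hU hω (hn t ht) (hN0 t ht) hp hpU hHp
    refine ⟨hdp, hdN, ?_, ?_⟩
    · exact ((WCI.hasVarDeriv_inner hΩ hp hut (hpu t ht)).sub hΩ hdp hut hv).congr_right hΩ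
        fun x _ => by simp only [WCI.lpVel, sub_neg_eq_add]
    -- At fixed p the term ∫ p·u does not depend on N, so only the sign of δH_W/δN changes.
    · exact (hdN.const_sub (∫ x in Ω, ⟪WCI.pseudomom N φ t x, u t x⟫)).congr_right hΩ
        fun x _ => neg_neg _
  · exact WCI.isWaveCurrent_iff_isClosedGLM hI hΩ hU hω hu hφ hN hN0 hkU hH
  · exact fun hΩc h => h.exists_phase_eq hI hΩ hΩc hU hω hu hφ hN hN0 hkU
  · intro h t ht η τ hη hηc hηs hτ hτc hτs
    exact h.integral_deriv_test hI hΩ hU hω hu hφ hN hN0 hkU ht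
      (hη.of_le (by exact_mod_cast le_top)) hηc hηs (hτ.of_le (by exact_mod_cast le_top)) hτc hτs
  · exact fun h t ht x hx i =>
      h.momTransport_split hI hΩ hU hω hR hu hD hφ hN hN0 hkU ht hx i
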